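/- Let $d\in\mathbb N$, $s>1$, and let $U\subseteq\mathbb R^d$ be a bounded open set. All functions are complex valued; for a multi-index $\alpha\in\mathbb N^d$ write $|\alpha|=\sum_j\alpha_j$, $\alpha!=\prod_j\alpha_j!$. **Spaces.** For $h>0$ and a compact set $K\subset\mathbb R^d$ let $\mathcal D^{s,h}_K$ be the space of all $f\in C^\infty(\mathbb R^d)$ with support in $K$ and finite norm $\sup_{\alpha}\sup_{x\in K} h^{|\alpha|}|D^\alpha f(x)|/\alpha!^s$. Let $\mathcal D^{(s)}_K=\varprojlim_{h\to\infty}\mathcal D^{s,h}_K$ (the intersection over all $h>0$ with the projective limit topology), and let $\mathcal D^{(s)}(U)$ be the union of the $\mathcal D^{(s)}_K$ over the compact sets $K\subseteq U$. For $1\le p\le\infty$ let $\mathcal D^s_{L^p,h}(U)$ be the space of all $\varphi\in C^\infty(U)$ with finite norm $\bigl(\sum_\alpha h^{p|\alpha|}\|D^\alpha\varphi\|_{L^p(U)}^p/\alpha!^{ps}\bigr)^{1/p}$ (respectively $\sup_\alpha h^{|\alpha|}\|D^\alpha\varphi\|_{L^\infty(U)}/\alpha!^s$ if $p=\infty$),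 and let $\mathcal D^{(s)}_{L^p,h}(U)$ be the closure of $\mathcal D^{(s)}(U)$ in $\mathcal D^s_{L^p,h}(U)$, with the induced norm. Let $\mathcal B^{(s)}_{L^\infty}(U)=\varprojlim_{h\to\infty}\mathcal D^s_{L^\infty,h}(U)$, and let $\dot{\mathcal B}^{(s)}(U)$ be the closure of $\mathcal D^{(s)}(U)$ in $\mathcal B^{(s)}_{L^\infty}(U)$, with the induced topology. An (FS)-space is a locally convex space that is the projective limit of a sequence of Banach spaces with compact linking maps. A Hausdorff locally convex space $E$ is nuclear if for every continuous seminorm $q$ the canonical map from $E$ to the completion $\hat E_q$ of $E/\ker q$ is nuclear. **Statement.** (i) Let $h>0$. For every $1\le p\le\infty$, every $\varphi\in\mathcal D^{(s)}_{L^p,h}(U)$ extends to a $C^\infty$ function on $\mathbb R^d$ with support in $\overline U$. Moreover, extension by zero is a linear isometry from $\mathcal D^{(s)}_{L^\infty,h}(U)$ onto a closed subspace of $\mathcal D^{s,h}_{\overline U}$. (ii) Extension by zero is a linear homeomorphism from $\dot{\mathcal B}^{(s)}(U)$ onto a closed subspace of $\mathcal D^{(s)}_{\overline U}$. (iii) $\dot{\mathcal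 B}^{(s)}(U)$ is a nuclear (FS)-space. Moreover, $\dot{\mathcal B}^{(s)}(U)=\varprojlim_{h\to\infty}\mathcal D^{(s)}_{L^\infty,h}(U)$ as locally convex spaces, and in this representation the linking inclusions $\mathcal D^{(s)}_{L^\infty,h_1}(U)\to\mathcal D^{(s)}_{L^\infty,h}(U)$ are compact for all $h_1>h>0$. -/

import Mathlib

open MeasureTheory TopologicalSpace Topology
open scoped ContDiff

noncomputable section

namespace Gevrey

/-! ### Multi-indices, partial derivatives, weights -/

/-- The Euclidean space `ℝ^d`. -/
abbrev Eu (d : ℕ) : Type := EuclideanSpace ℝ (Fin d)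

variable {d : ℕ}

/-- The list of coordinate directions in which `∂^α` differentiates: the coordinate `j` is
listed `α j` times. -/
def dirs (α : Fin d → ℕ) : List (Fin d) :=
  (List.finRange d).flatMap fun j => List.replicate (α j) j

theorem dirs_length (α : Fin d → ℕ) : (dirs α).length = ∑ j, α j := by
  simp [dirs, List.length_flatMap, Fin.sum_univ_def]

theorem count_dirs (α : Fin d → ℕ) (i : Fin d) : (dirs α).count i = α i := by
  simp only [dirs, List.count_flatMap]
  have h : (List.count i ∘ fun j => List.replicate (α j) j) = fun j => if j = i then α i else 0 := by
    funext j
    by_cases hj : j = i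
    · subst hj; simp
    · simp [List.count_replicate, hj]
  rw [h, ← Fin.sum_univ_def]
  simp

/-- The partial derivative `∂^α f (x)`. Here `∂^α` replaces `D^α = i^{-|α|} ∂^α`: only the absolute
values of the derivatives matter below. -/
def pderiv (α : Fin d → ℕ) (f : Eu d → ℂ) (x : Eu d) : ℂ :=
  iteratedFDeriv ℝ (dirs α).length f x fun i => EuclideanSpace.single ((dirs α).get i) (1 : ℝ)

/-- The weight `h^{|α|} / α!^s`. -/
def weight (s h : ℝ) (α : Fin d → ℕ) : ℝ :=
  h ^ (∑ j, α j) / ((∏ j, (α j).factorial : ℕ) : ℝ) ^ s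

theorem weight_pos (s : ℝ) {h : ℝ} (hh : 0 < h) (α : Fin d → ℕ) : 0 < weight s h α := by
  have : (0 : ℝ) < ((∏ j, (α j).factorial : ℕ) : ℝ) := by
    exact_mod_cast Finset.prod_pos fun j _ => (α j).factorial_pos
  unfold weight
  positivity

theorem pderiv_add (α : Fin d → ℕ) {f g : Eu d → ℂ} {x : Eu d}
    (hf : ContDiffAt ℝ ∞ f x) (hg : ContDiffAt ℝ ∞ g x) :
    pderiv α (f + g) x = pderiv α f x + pderiv α g x := by
  unfold pderiv
  rw [iteratedFDeriv_add_apply (hf.of_le (by exact_mod_cast le_top))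
    (hg.of_le (by exact_mod_cast le_top))]
  rfl

theorem pderiv_smul (α : Fin d → ℕ) (c : ℂ) {f : Eu d → ℂ} {x : Eu d}
    (hf : ContDiffAt ℝ ∞ f x) : pderiv α (c • f) x = c * pderiv α f x := by
  unfold pderiv
  rw [iteratedFDeriv_const_smul_apply (hf.of_le (by exact_mod_cast le_top))]
  rfl

theorem pderiv_zero (f : Eu d → ℂ) : pderiv 0 f = f := by
  have h0 : (dirs (0 : Fin d → ℕ)) = [] := List.length_eq_zero_iff.1 (by simp [dirs_length])
  funext x
  unfold pderiv
  rw [h0]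
  simp

/-! ### The spaces `D^{s,h}_K` and `D^{(s)}_K` -/

/-- `sup_α sup_{x ∈ K} h^{|α|} |∂^α f(x)| / α!^s`. -/
def supENorm (s h : ℝ) (K : Set (Eu d)) (f : Eu d → ℂ) : ENNReal :=
  ⨆ α : Fin d → ℕ, ⨆ x ∈ K, ENNReal.ofReal (weight s h α) * ‖pderiv α f x‖ₑ

theorem supENorm_ge (s h : ℝ) {K : Set (Eu d)} {x : Eu d} (hx : x ∈ K) (f : Eu d → ℂ)
    (α : Fin d → ℕ) : ENNReal.ofReal (weight s h α) * ‖pderiv α f x‖ₑ ≤ supENorm s h K f :=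
  (le_iSup₂ (f := fun x (_ : x ∈ K) => ENNReal.ofReal (weight s h α) * ‖pderiv α f x‖ₑ) x hx).trans
    (le_iSup (fun α => ⨆ x ∈ K, ENNReal.ofReal (weight s h α) * ‖pderiv α f x‖ₑ) α)

theorem supENorm_add_le (s h : ℝ) (K : Set (Eu d)) {f g : Eu d → ℂ}
    (hf : ContDiff ℝ ∞ f) (hg : ContDiff ℝ ∞ g) :
    supENorm s h K (f + g) ≤ supENorm s h K f + supENorm s h K g := by
  refine iSup_le fun α => iSup₂_le fun x hx => ?_
  rw [pderiv_add α hf.contDiffAt hg.contDiffAt]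
  calc _ ≤ ENNReal.ofReal (weight s h α) * (‖pderiv α f x‖ₑ + ‖pderiv α g x‖ₑ) := by
        gcongr; exact enorm_add_le _ _
    _ = _ := mul_add _ _ _
    _ ≤ _ := add_le_add (supENorm_ge s h hx f α) (supENorm_ge s h hx g α)

theorem supENorm_smul (s h : ℝ) (K : Set (Eu d)) (c : ℂ) {f : Eu d → ℂ}
    (hf : ContDiff ℝ ∞ f) : supENorm s h K (c • f) = ‖c‖ₑ * supENorm s h K f := by
  simp only [supENorm, ENNReal.mul_iSup]
  refine iSup_congr fun α => iSup_congr fun x => iSup_congr fun _ => ?_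
  rw [pderiv_smul α c hf.contDiffAt, enorm_mul]
  ring

theorem supENorm_zero (s h : ℝ) (K : Set (Eu d)) : supENorm s h K 0 = 0 := by
  have := supENorm_smul s h K 0 (f := 0) contDiff_const
  simpa using this

/-- The functions in `C^∞(ℝ^d)` with support in `K` and with
`sup_α sup_{x ∈ K} h^{|α|} |∂^α f(x)| / α!^s < ∞`. -/
def compSubmodule (s h : ℝ) (K : Set (Eu d)) : Submodule ℂ (Eu d → ℂ) where
  carrier := {f | ContDiff ℝ ∞ f ∧ tsupport f ⊆ K ∧ supENorm s h K f < ⊤}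
  zero_mem' := ⟨contDiff_const, by simp [tsupport], by
    change supENorm s h K 0 < ⊤
    rw [supENorm_zero]; exact ENNReal.zero_lt_top⟩
  add_mem' := by
    rintro f g ⟨hf, hfK, hf'⟩ ⟨hg, hgK, hg'⟩
    exact ⟨hf.add hg, (tsupport_add f g).trans (Set.union_subset hfK hgK),
      (supENorm_add_le s h K hf hg).trans_lt (ENNReal.add_lt_top.2 ⟨hf', hg'⟩)⟩
  smul_mem' := by
    rintro c f ⟨hf, hfK, hf'⟩
    refine ⟨hf.const_smul c, (closure_mono ?_).trans hfK, ?_⟩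
    · exact Function.support_const_smul_subset c f
    · rw [supENorm_smul s h K c hf]
      exact ENNReal.mul_lt_top enorm_lt_top hf'

/-- The space `D^{s,h}_K`, as a type. -/
def Comp (s : ℝ) (h : Set.Ioi (0 : ℝ)) (K : Set (Eu d)) : Type := compSubmodule s h.1 K

instance (s : ℝ) (h : Set.Ioi (0 : ℝ)) (K : Set (Eu d)) : AddCommGroup (Comp s h K) :=
  inferInstanceAs (AddCommGroup (compSubmodule s h.1 K))

instance (s : ℝ) (h : Set.Ioi (0 : ℝ)) (K : Set (Eu d)) : Module ℂ (Comp s h K) :=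
  inferInstanceAs (Module ℂ (compSubmodule s h.1 K))

/-- The function on `ℝ^d` underlying an element of `D^{s,h}_K`. -/
def Comp.fn {s : ℝ} {h : Set.Ioi (0 : ℝ)} {K : Set (Eu d)} (f : Comp s h K) : Eu d → ℂ := f.1

/-- The norm `sup_α sup_{x ∈ K} h^{|α|} |∂^α f(x)| / α!^s` of `D^{s,h}_K`. -/
instance (s : ℝ) (h : Set.Ioi (0 : ℝ)) (K : Set (Eu d)) : Norm (Comp s h K) :=
  ⟨fun f => (supENorm s h.1 K f.fn).toReal⟩

theorem Comp.core (s : ℝ) (h : Set.Ioi (0 : ℝ)) (K : Set (Eu d)) :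
    NormedSpace.Core ℂ (Comp s h K) where
  norm_nonneg _ := ENNReal.toReal_nonneg
  norm_smul c f := by
    change (supENorm s h.1 K (c • f.fn)).toReal = ‖c‖ * (supENorm s h.1 K f.fn).toReal
    rw [supENorm_smul s h.1 K c (f := f.fn) f.2.1, ENNReal.toReal_mul, toReal_enorm]
  norm_triangle f g := by
    change (supENorm s h.1 K (f.fn + g.fn)).toReal ≤
      (supENorm s h.1 K f.fn).toReal + (supENorm s h.1 K g.fn).toReal
    rw [← ENNReal.toReal_add (a := supENorm s h.1 K f.fn) (b := supENorm s h.1 K g.fn)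
      f.2.2.2.ne g.2.2.2.ne]
    exact ENNReal.toReal_mono (ENNReal.add_lt_top.2 ⟨f.2.2.2, g.2.2.2⟩).ne
      (supENorm_add_le s h.1 K f.2.1 g.2.1)
  norm_eq_zero_iff f := by
    change (supENorm s h.1 K f.fn).toReal = 0 ↔ f = 0
    constructor
    · intro H
      have H' : supENorm s h.1 K f.fn = 0 :=
        ((ENNReal.toReal_eq_zero_iff _).1 H).resolve_right f.2.2.2.ne
      refine Subtype.ext (funext fun x => ?_)
      change f.fn x = 0
      by_cases hx : x ∈ K
      · have h1 : ENNReal.ofReal (weight s h.1 (0 : Fin d → ℕ)) * ‖pderiv 0 f.fn x‖ₑ ≤ 0 := by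
          rw [← H']
          exact supENorm_ge s h.1 hx f.fn 0
        have h2 := weight_pos (d := d) s h.2 0
        rw [pderiv_zero] at h1
        have h3 := (mul_eq_zero.1 (nonpos_iff_eq_zero.1 h1)).resolve_left (by simpa using h2)
        simpa using h3
      · exact image_eq_zero_of_notMem_tsupport fun hx' => hx (f.2.2.1 hx')
    · rintro rfl
      change (supENorm s h.1 K 0).toReal = 0
      rw [supENorm_zero]; rfl

instance (s : ℝ) (h : Set.Ioi (0 : ℝ)) (K : Set (Eu d)) : NormedAddCommGroup (Comp s h K) :=
  NormedAddCommGroup.ofCore (Comp.core s h K)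

instance (s : ℝ) (h : Set.Ioi (0 : ℝ)) (K : Set (Eu d)) : NormedSpace ℂ (Comp s h K) :=
  NormedSpace.ofCore (Comp.core s h K)

/-- The functions that lie in `D^{s,h}_K` for every `h > 0`. -/
def beurlingCompSubmodule (s : ℝ) (K : Set (Eu d)) : Submodule ℂ (Eu d → ℂ) :=
  ⨅ h : Set.Ioi (0 : ℝ), compSubmodule s h.1 K

/-- The space `D^{(s)}_K`, the projective limit of the spaces `D^{s,h}_K`, as a type. -/
def BeurlingComp (s : ℝ) (K : Set (Eu d)) : Type := beurlingCompSubmodule s K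

instance (s : ℝ) (K : Set (Eu d)) : AddCommGroup (BeurlingComp s K) :=
  inferInstanceAs (AddCommGroup (beurlingCompSubmodule s K))

instance (s : ℝ) (K : Set (Eu d)) : Module ℂ (BeurlingComp s K) :=
  inferInstanceAs (Module ℂ (beurlingCompSubmodule s K))

/-- The function on `ℝ^d` underlying an element of `D^{(s)}_K`. -/
def BeurlingComp.fn {s : ℝ} {K : Set (Eu d)} (f : BeurlingComp s K) : Eu d → ℂ := f.1

/-- The inclusion `D^{(s)}_K → D^{s,h}_K`. -/
def BeurlingComp.incl (s : ℝ) (K : Set (Eu d)) (h : Set.Ioi (0 : ℝ)) :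
    BeurlingComp s K →ₗ[ℂ] Comp s h K :=
  Submodule.inclusion (iInf_le (fun h : Set.Ioi (0 : ℝ) => compSubmodule s h.1 K) h)

/-- The projective limit topology of `D^{(s)}_K`. -/
instance (s : ℝ) (K : Set (Eu d)) : TopologicalSpace (BeurlingComp s K) :=
  ⨅ h : Set.Ioi (0 : ℝ), TopologicalSpace.induced (BeurlingComp.incl s K h) inferInstance

instance (s : ℝ) (K : Set (Eu d)) : IsTopologicalAddGroup (BeurlingComp s K) :=
  topologicalAddGroup_iInf fun h => topologicalAddGroup_induced (BeurlingComp.incl s K h)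

instance (s : ℝ) (K : Set (Eu d)) : ContinuousSMul ℂ (BeurlingComp s K) :=
  continuousSMul_iInf fun h => continuousSMul_induced (BeurlingComp.incl s K h)

/-! ### Functions on an open set -/

/-- The extension by zero of a function on `U` to `ℝ^d`. -/
def zeroExt (U : Opens (Eu d)) (φ : U → ℂ) (x : Eu d) : ℂ :=
  open scoped Classical in if hx : x ∈ U then φ ⟨x, hx⟩ else 0

theorem zeroExt_add (U : Opens (Eu d)) (φ ψ : U → ℂ) :
    zeroExt U (φ + ψ) = zeroExt U φ + zeroExt U ψ := by
  funext x; by_cases hx : x ∈ U <;> simp [zeroExt, hx]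

theorem zeroExt_smul (U : Opens (Eu d)) (c : ℂ) (φ : U → ℂ) :
    zeroExt U (c • φ) = c • zeroExt U φ := by
  funext x; by_cases hx : x ∈ U <;> simp [zeroExt, hx]

theorem zeroExt_zero (U : Opens (Eu d)) : zeroExt U 0 = 0 := by
  funext x; simp [zeroExt]

/-- `φ ∈ C^∞(U)`. (At the points of the open set `U` the values that `zeroExt` takes off `U` are
irrelevant for derivatives.) -/
def IsSmooth (U : Opens (Eu d)) (φ : U → ℂ) : Prop := ContDiffOn ℝ ∞ (zeroExt U φ) U

theorem IsSmooth.contDiffAt {U : Opens (Eu d)} {φ : U → ℂ} (hφ : IsSmooth U φ) {x : Eu d}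
    (hx : x ∈ U) : ContDiffAt ℝ ∞ (zeroExt U φ) x :=
  ContDiffOn.contDiffAt hφ (U.isOpen.mem_nhds hx)

theorem IsSmooth.add {U : Opens (Eu d)} {φ ψ : U → ℂ} (hφ : IsSmooth U φ) (hψ : IsSmooth U ψ) :
    IsSmooth U (φ + ψ) := by
  unfold IsSmooth; rw [zeroExt_add]; exact ContDiffOn.add hφ hψ

theorem IsSmooth.smul {U : Opens (Eu d)} {φ : U → ℂ} (hφ : IsSmooth U φ) (c : ℂ) :
    IsSmooth U (c • φ) := by
  unfold IsSmooth; rw [zeroExt_smul]; exact ContDiffOn.const_smul c hφ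

theorem IsSmooth.zero (U : Opens (Eu d)) : IsSmooth U 0 := by
  unfold IsSmooth; rw [zeroExt_zero]; exact contDiffOn_const

/-- `‖∂^α φ‖_{L^p(U)}`. -/
def derivENorm (p : ENNReal) (U : Opens (Eu d)) (φ : U → ℂ) (α : Fin d → ℕ) : ENNReal :=
  eLpNorm (pderiv α (zeroExt U φ)) p (volume.restrict (U : Set (Eu d)))

theorem pderiv_continuousOn {U : Opens (Eu d)} {φ : U → ℂ} (hφ : IsSmooth U φ)
    (α : Fin d → ℕ) : ContinuousOn (pderiv α (zeroExt U φ)) U := by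
  intro x hx
  have h1 : ContinuousAt (iteratedFDeriv ℝ (dirs α).length (zeroExt U φ)) x := by
    have := (hφ.contDiffAt hx).iteratedFDeriv_right (m := 0) (i := (dirs α).length)
      (by simp; exact_mod_cast le_top)
    exact this.continuousAt
  have h2 : ContinuousAt (pderiv α (zeroExt U φ)) x :=
    h1.eval_const (x := fun i => EuclideanSpace.single ((dirs α).get i) (1 : ℝ))
  exact h2.continuousWithinAt

theorem pderiv_aestronglyMeasurable {U : Opens (Eu d)} {φ : U → ℂ} (hφ : IsSmooth U φ)
    (α : Fin d → ℕ) :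
    AEStronglyMeasurable (pderiv α (zeroExt U φ)) (volume.restrict (U : Set (Eu d))) :=
  (pderiv_continuousOn hφ α).aestronglyMeasurable U.isOpen.measurableSet

theorem derivENorm_add_le {p : ENNReal} (hp : 1 ≤ p) {U : Opens (Eu d)} {φ ψ : U → ℂ}
    (hφ : IsSmooth U φ) (hψ : IsSmooth U ψ) (α : Fin d → ℕ) :
    derivENorm p U (φ + ψ) α ≤ derivENorm p U φ α + derivENorm p U ψ α := by
  have h : derivENorm p U (φ + ψ) α =
      eLpNorm (pderiv α (zeroExt U φ) + pderiv α (zeroExt U ψ)) p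
        (volume.restrict (U : Set (Eu d))) := by
    refine eLpNorm_congr_ae ?_
    filter_upwards [ae_restrict_mem U.isOpen.measurableSet] with x hx
    rw [zeroExt_add, pderiv_add α (hφ.contDiffAt hx) (hψ.contDiffAt hx)]
    rfl
  rw [h]
  exact eLpNorm_add_le (pderiv_aestronglyMeasurable hφ α) (pderiv_aestronglyMeasurable hψ α) hp

theorem derivENorm_smul (p : ENNReal) {U : Opens (Eu d)} {φ : U → ℂ}
    (hφ : IsSmooth U φ) (c : ℂ) (α : Fin d → ℕ) :
    derivENorm p U (c • φ) α = ‖c‖ₑ * derivENorm p U φ α := by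
  have h : derivENorm p U (c • φ) α =
      eLpNorm (c • pderiv α (zeroExt U φ)) p (volume.restrict (U : Set (Eu d))) := by
    refine eLpNorm_congr_ae ?_
    filter_upwards [ae_restrict_mem U.isOpen.measurableSet] with x hx
    rw [zeroExt_smul, pderiv_smul α c (hφ.contDiffAt hx)]
    rfl
  rw [h, eLpNorm_const_smul]
  rfl

/-! ### The spaces `D^s_{L^p,h}(U)` and `D^{(s)}_{L^p,h}(U)` -/

/-- `(∑_α (h^{|α|} ‖∂^α φ‖_{L^p(U)} / α!^s)^p)^{1/p}` for `p < ∞`, and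
`sup_α h^{|α|} ‖∂^α φ‖_{L^∞(U)} / α!^s` for `p = ∞`. -/
def lpENorm (s : ℝ) (p : ENNReal) (h : ℝ) (U : Opens (Eu d)) (φ : U → ℂ) : ENNReal :=
  if p = ⊤ then ⨆ α : Fin d → ℕ, ENNReal.ofReal (weight s h α) * derivENorm p U φ α
  else (∑' α : Fin d → ℕ,
    (ENNReal.ofReal (weight s h α) * derivENorm p U φ α) ^ p.toReal) ^ (1 / p.toReal)

theorem lpENorm_add_le (s : ℝ) {p : ENNReal} (hp : 1 ≤ p) (h : ℝ) {U : Opens (Eu d)}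
    {φ ψ : U → ℂ} (hφ : IsSmooth U φ) (hψ : IsSmooth U ψ) :
    lpENorm s p h U (φ + ψ) ≤ lpENorm s p h U φ + lpENorm s p h U ψ := by
  have key : ∀ α, ENNReal.ofReal (weight s h α) * derivENorm p U (φ + ψ) α ≤
      ENNReal.ofReal (weight s h α) * derivENorm p U φ α +
        ENNReal.ofReal (weight s h α) * derivENorm p U ψ α := fun α => by
    rw [← mul_add]; gcongr; exact derivENorm_add_le hp hφ hψ α
  unfold lpENorm
  split_ifs with hpt
  · refine iSup_le fun α => (key α).trans (add_le_add ?_ ?_)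
    · exact le_iSup (fun α => ENNReal.ofReal (weight s h α) * derivENorm p U φ α) α
    · exact le_iSup (fun α => ENNReal.ofReal (weight s h α) * derivENorm p U ψ α) α
  · have hp1 : 1 ≤ p.toReal := by
      rw [← ENNReal.toReal_one]; exact ENNReal.toReal_mono hpt hp
    calc _ ≤ (∑' α : Fin d → ℕ, (ENNReal.ofReal (weight s h α) * derivENorm p U φ α +
          ENNReal.ofReal (weight s h α) * derivENorm p U ψ α) ^ p.toReal) ^ (1 / p.toReal) := by
          gcongr with α; exact key α
      _ ≤ _ := by
          have := ENNReal.lintegral_Lp_add_le (μ := Measure.count)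
            (f := fun α : Fin d → ℕ => ENNReal.ofReal (weight s h α) * derivENorm p U φ α)
            (g := fun α : Fin d → ℕ => ENNReal.ofReal (weight s h α) * derivENorm p U ψ α)
            (Measurable.of_discrete.aemeasurable) (Measurable.of_discrete.aemeasurable) hp1
          simpa [lintegral_count] using this

theorem lpENorm_smul (s : ℝ) {p : ENNReal} (hp : 1 ≤ p) (h : ℝ) {U : Opens (Eu d)}
    {φ : U → ℂ} (hφ : IsSmooth U φ) (c : ℂ) :
    lpENorm s p h U (c • φ) = ‖c‖ₑ * lpENorm s p h U φ := by
  have key : ∀ α, ENNReal.ofReal (weight s h α) * derivENorm p U (c • φ) α =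
      ‖c‖ₑ * (ENNReal.ofReal (weight s h α) * derivENorm p U φ α) := fun α => by
    rw [derivENorm_smul p hφ c α]; ring
  simp only [lpENorm, key]
  split_ifs with hpt
  · rw [ENNReal.mul_iSup]
  · have hp1 : 1 ≤ p.toReal := by
      rw [← ENNReal.toReal_one]; exact ENNReal.toReal_mono hpt hp
    have hp0 : p.toReal ≠ 0 := by linarith
    simp only [ENNReal.mul_rpow_of_nonneg _ _ (zero_le_one.trans hp1), ENNReal.tsum_mul_left]
    rw [ENNReal.mul_rpow_of_nonneg _ _ (by positivity), ← ENNReal.rpow_mul,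
      mul_one_div_cancel hp0, ENNReal.rpow_one]

theorem lpENorm_zero (s : ℝ) {p : ENNReal} (hp : 1 ≤ p) (h : ℝ) (U : Opens (Eu d)) :
    lpENorm s p h U 0 = 0 := by
  have := lpENorm_smul s hp h (IsSmooth.zero U) 0
  simpa using this

theorem derivENorm_eq_zero {s : ℝ} {p : ENNReal} (hp : 1 ≤ p) {h : ℝ} (hh : 0 < h)
    {U : Opens (Eu d)} {φ : U → ℂ} (H : lpENorm s p h U φ = 0) (α : Fin d → ℕ) :
    derivENorm p U φ α = 0 := by
  have hw := weight_pos s hh α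
  have key : ENNReal.ofReal (weight s h α) * derivENorm p U φ α = 0 := by
    unfold lpENorm at H
    split_ifs at H with hpt
    · exact (ENNReal.iSup_eq_zero.1 H) α
    · have hp1 : 1 ≤ p.toReal := by
        rw [← ENNReal.toReal_one]; exact ENNReal.toReal_mono hpt hp
      have hp0 : 0 < p.toReal := by linarith
      rw [ENNReal.rpow_eq_zero_iff_of_pos (by positivity), ENNReal.tsum_eq_zero] at H
      exact (ENNReal.rpow_eq_zero_iff_of_pos hp0).1 (H α)
  exact (mul_eq_zero.1 key).resolve_left (by simpa using hw)

theorem eq_zero_of_lpENorm {s : ℝ} {p : ENNReal} (hp : 1 ≤ p) {h : ℝ} (hh : 0 < h)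
    {U : Opens (Eu d)} {φ : U → ℂ} (hφ : IsSmooth U φ) (H : lpENorm s p h U φ = 0) : φ = 0 := by
  have h0 := derivENorm_eq_zero hp hh H 0
  unfold derivENorm at h0
  rw [eLpNorm_eq_zero_iff (pderiv_aestronglyMeasurable hφ 0)
    (zero_lt_one.trans_le hp).ne'] at h0
  have h1 := Measure.eqOn_open_of_ae_eq h0 U.isOpen (pderiv_continuousOn hφ 0) continuousOn_const
  rw [pderiv_zero] at h1
  funext x
  simpa [zeroExt] using h1 x.2

/-- The functions in `C^∞(U)` with finite `D^s_{L^p,h}(U)`-norm. -/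
def lpSubmodule (s : ℝ) (p : ENNReal) [hp : Fact (1 ≤ p)] (h : ℝ) (U : Opens (Eu d)) :
    Submodule ℂ (U → ℂ) where
  carrier := {φ | IsSmooth U φ ∧ lpENorm s p h U φ < ⊤}
  zero_mem' := ⟨IsSmooth.zero U, by
    change lpENorm s p h U 0 < ⊤
    rw [lpENorm_zero s hp.out]; exact ENNReal.zero_lt_top⟩
  add_mem' := by
    rintro φ ψ ⟨hφ, hφ'⟩ ⟨hψ, hψ'⟩
    exact ⟨hφ.add hψ, (lpENorm_add_le s hp.out h hφ hψ).trans_lt (ENNReal.add_lt_top.2 ⟨hφ', hψ'⟩)⟩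
  smul_mem' := by
    rintro c φ ⟨hφ, hφ'⟩
    refine ⟨hφ.smul c, ?_⟩
    rw [lpENorm_smul s hp.out h hφ]
    exact ENNReal.mul_lt_top enorm_lt_top hφ'

section Lp

variable (s : ℝ) (p : ENNReal) [hp : Fact (1 ≤ p)] (h : Set.Ioi (0 : ℝ)) (U : Opens (Eu d))

/-- The space `D^s_{L^p,h}(U)`, as a type. -/
def LpSpace : Type := lpSubmodule s p h.1 U

instance : AddCommGroup (LpSpace s p h U) :=
  inferInstanceAs (AddCommGroup (lpSubmodule s p h.1 U))

instance : Module ℂ (LpSpace s p h U) :=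
  inferInstanceAs (Module ℂ (lpSubmodule s p h.1 U))

variable {s p h U} in
/-- The function on `U` underlying an element of `D^s_{L^p,h}(U)`. -/
def LpSpace.fn (φ : LpSpace s p h U) : U → ℂ := φ.1

/-- The forgetful linear map from `D^s_{L^p,h}(U)` to the functions on `U`. -/
def LpSpace.fnₗ : LpSpace s p h U →ₗ[ℂ] (U → ℂ) := (lpSubmodule s p h.1 U).subtype

instance : Norm (LpSpace s p h U) := ⟨fun φ => (lpENorm s p h.1 U φ.fn).toReal⟩

theorem LpSpace.core : NormedSpace.Core ℂ (LpSpace s p h U) where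
  norm_nonneg _ := ENNReal.toReal_nonneg
  norm_smul c φ := by
    change (lpENorm s p h.1 U (c • φ.fn)).toReal = ‖c‖ * (lpENorm s p h.1 U φ.fn).toReal
    rw [lpENorm_smul s hp.out h.1 (φ := φ.fn) φ.2.1, ENNReal.toReal_mul, toReal_enorm]
  norm_triangle φ ψ := by
    change (lpENorm s p h.1 U (φ.fn + ψ.fn)).toReal ≤
      (lpENorm s p h.1 U φ.fn).toReal + (lpENorm s p h.1 U ψ.fn).toReal
    rw [← ENNReal.toReal_add (a := lpENorm s p h.1 U φ.fn) (b := lpENorm s p h.1 U ψ.fn)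
      φ.2.2.ne ψ.2.2.ne]
    exact ENNReal.toReal_mono (ENNReal.add_lt_top.2 ⟨φ.2.2, ψ.2.2⟩).ne
      (lpENorm_add_le s hp.out h.1 φ.2.1 ψ.2.1)
  norm_eq_zero_iff φ := by
    change (lpENorm s p h.1 U φ.fn).toReal = 0 ↔ φ = 0
    constructor
    · intro H
      have H' : lpENorm s p h.1 U φ.fn = 0 :=
        ((ENNReal.toReal_eq_zero_iff _).1 H).resolve_right φ.2.2.ne
      exact Subtype.ext (eq_zero_of_lpENorm hp.out h.2 φ.2.1 H')
    · rintro rfl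
      change (lpENorm s p h.1 U 0).toReal = 0
      rw [lpENorm_zero s hp.out]; rfl

instance : NormedAddCommGroup (LpSpace s p h U) :=
  NormedAddCommGroup.ofCore (LpSpace.core s p h U)

instance : NormedSpace ℂ (LpSpace s p h U) :=
  NormedSpace.ofCore (LpSpace.core s p h U)

end Lp

theorem zeroExt_mem_mono {s : ℝ} {K L : Set (Eu d)} (hKL : K ⊆ L) {f : Eu d → ℂ}
    (hf : f ∈ beurlingCompSubmodule s K) : f ∈ beurlingCompSubmodule s L := by
  simp only [beurlingCompSubmodule, Submodule.mem_iInf] at hf ⊢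
  intro h
  obtain ⟨h1, h2, h3⟩ := hf h
  refine ⟨h1, h2.trans hKL, lt_of_le_of_lt ?_ h3⟩
  refine iSup_le fun α => iSup₂_le fun x _ => ?_
  by_cases hxK : x ∈ K
  · exact supENorm_ge s h.1 hxK f α
  · have hz : iteratedFDeriv ℝ (dirs α).length f x = 0 :=
      image_eq_zero_of_notMem_tsupport fun hx =>
        hxK (h2 (tsupport_iteratedFDeriv_subset _ hx))
    simp [pderiv, hz]

/-- The space `D^{(s)}(U)`, the union of the spaces `D^{(s)}_K` over the compact sets `K ⊆ U`,
as a space of functions on `U`. -/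
def testSubmodule (s : ℝ) (U : Opens (Eu d)) : Submodule ℂ (U → ℂ) where
  carrier := {φ | ∃ K : Set (Eu d), IsCompact K ∧ K ⊆ U ∧
    zeroExt U φ ∈ beurlingCompSubmodule s K}
  zero_mem' := ⟨∅, isCompact_empty, Set.empty_subset _, by
    rw [zeroExt_zero]; exact Submodule.zero_mem _⟩
  add_mem' := by
    rintro φ ψ ⟨K, hK, hKU, hφ⟩ ⟨L, hL, hLU, hψ⟩
    refine ⟨K ∪ L, hK.union hL, Set.union_subset hKU hLU, ?_⟩
    rw [zeroExt_add]
    exact Submodule.add_mem _ (zeroExt_mem_mono Set.subset_union_left hφ)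
      (zeroExt_mem_mono Set.subset_union_right hψ)
  smul_mem' := by
    rintro c φ ⟨K, hK, hKU, hφ⟩
    refine ⟨K, hK, hKU, ?_⟩
    rw [zeroExt_smul]
    exact Submodule.smul_mem _ c hφ

/-- The space `D^{(s)}_{L^p,h}(U)`: the closure of `D^{(s)}(U)` in `D^s_{L^p,h}(U)`, with the
induced norm. -/
def LpClosure (s : ℝ) (p : ENNReal) [Fact (1 ≤ p)] (h : Set.Ioi (0 : ℝ)) (U : Opens (Eu d)) :
    Submodule ℂ (LpSpace s p h U) :=
  ((testSubmodule s U).comap (LpSpace.fnₗ s p h U)).topologicalClosure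

/-! ### The spaces `B^{(s)}_{L^p}(U)` and `Ḃ^{(s)}(U)` -/

section Beurling

variable (s : ℝ) (p : ENNReal) [hp : Fact (1 ≤ p)] (U : Opens (Eu d))

/-- The functions that lie in `D^s_{L^p,h}(U)` for every `h > 0`. -/
def beurlingSubmodule : Submodule ℂ (U → ℂ) := ⨅ h : Set.Ioi (0 : ℝ), lpSubmodule s p h.1 U

/-- The space `B^{(s)}_{L^p}(U)`, the projective limit of the spaces `D^s_{L^p,h}(U)`,
as a type. -/
def Beurling : Type := beurlingSubmodule s p U

instance : AddCommGroup (Beurling s p U) := inferInstanceAs (AddCommGroup (beurlingSubmodule s p U))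

instance : Module ℂ (Beurling s p U) := inferInstanceAs (Module ℂ (beurlingSubmodule s p U))

variable {s p U} in
/-- The function on `U` underlying an element of `B^{(s)}_{L^p}(U)`. -/
def Beurling.fn (φ : Beurling s p U) : U → ℂ := φ.1

/-- The forgetful linear map from `B^{(s)}_{L^p}(U)` to the functions on `U`. -/
def Beurling.fnₗ : Beurling s p U →ₗ[ℂ] (U → ℂ) := (beurlingSubmodule s p U).subtype

/-- The inclusion `B^{(s)}_{L^p}(U) → D^s_{L^p,h}(U)`. -/
def Beurling.incl (h : Set.Ioi (0 : ℝ)) : Beurling s p U →ₗ[ℂ] LpSpace s p h U :=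
  Submodule.inclusion (iInf_le (fun h : Set.Ioi (0 : ℝ) => lpSubmodule s p h.1 U) h)

/-- The projective limit topology of `B^{(s)}_{L^p}(U)`. -/
instance : TopologicalSpace (Beurling s p U) :=
  ⨅ h : Set.Ioi (0 : ℝ), TopologicalSpace.induced (Beurling.incl s p U h) inferInstance

instance : IsTopologicalAddGroup (Beurling s p U) :=
  topologicalAddGroup_iInf fun h => topologicalAddGroup_induced (Beurling.incl s p U h)

instance : ContinuousSMul ℂ (Beurling s p U) :=
  continuousSMul_iInf fun h => continuousSMul_induced (Beurling.incl s p U h)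

end Beurling

/-- The space `Ḃ^{(s)}(U)`: the closure of `D^{(s)}(U)` in `B^{(s)}_{L^∞}(U)`, with the induced
topology. -/
def BDot (s : ℝ) (U : Opens (Eu d)) : Submodule ℂ (Beurling s ⊤ U) :=
  ((testSubmodule s U).comap (Beurling.fnₗ s ⊤ U)).topologicalClosure

end Gevrey

universe u

/-! ### Projective limits, (FS)-spaces and nuclear spaces -/

/-- `E`, with the continuous linear maps `π i : E → X i`, is the projective limit (as a topological
vector space) of the projective system `u i j : X j → X i`, `i ≤ j`: the `π i` identify `E`, with
its topology, with the space of threads in the product of the `X i`. -/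
structure IsTVSProjectiveLimit {ι : Type*} [Preorder ι] {E : Type*} [AddCommGroup E] [Module ℂ E]
    [TopologicalSpace E] {X : ι → Type*} [∀ i, NormedAddCommGroup (X i)]
    [∀ i, NormedSpace ℂ (X i)] (u : ∀ i j, i ≤ j → (X j →L[ℂ] X i)) (π : ∀ i, E →L[ℂ] X i) :
    Prop where
  link_refl : ∀ i x, u i i le_rfl x = x
  link_trans : ∀ i j k (hij : i ≤ j) (hjk : j ≤ k) x, u i j hij (u j k hjk x) = u i k (hij.trans hjk) x
  isEmbedding : IsEmbedding fun (x : E) (i : ι) => π i x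
  range_eq : (Set.range fun (x : E) (i : ι) => π i x) =
    {y | ∀ i j (hij : i ≤ j), u i j hij (y j) = y i}

/-- An (FS)-space: a projective limit of a sequence of Banach spaces with compact linking maps. -/
def IsFSSpace (E : Type u) [AddCommGroup E] [Module ℂ E] [TopologicalSpace E] : Prop :=
  ∃ (X : ℕ → Type u) (_ : ∀ n, NormedAddCommGroup (X n)) (_ : ∀ n, NormedSpace ℂ (X n))
    (u : ∀ m n, m ≤ n → (X n →L[ℂ] X m)) (π : ∀ n, E →L[ℂ] X n),
    (∀ n, CompleteSpace (X n)) ∧ IsTVSProjectiveLimit u π ∧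
      ∀ m n (hmn : m < n), IsCompactOperator (u m n hmn.le)

/-- The space `E` with the single seminorm `q`. -/
def SeminormSpace {E : Type*} [AddCommGroup E] [Module ℂ E] (_ : Seminorm ℂ E) : Type _ := E

section Nuclear

variable {E : Type*} [AddCommGroup E] [Module ℂ E]

instance (q : Seminorm ℂ E) : SeminormedAddCommGroup (SeminormSpace q) :=
  q.toAddGroupSeminorm.toSeminormedAddCommGroup

instance (q : Seminorm ℂ E) : Module ℂ (SeminormSpace q) := inferInstanceAs (Module ℂ E)

instance (q : Seminorm ℂ E) : NormedSpace ℂ (SeminormSpace q) :=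
  ⟨fun c x => (map_smul_eq_mul q c x).le⟩

/-- The local Banach space of the seminorm `q`: the (Hausdorff) completion of `(E, q)`, that is,
the completion of the normed space `E / ker q`. -/
abbrev LocalBanach (q : Seminorm ℂ E) : Type _ := UniformSpace.Completion (SeminormSpace q)

/-- The canonical map from `E` to the local Banach space of `q`. -/
def toLocalBanach (q : Seminorm ℂ E) : E →ₗ[ℂ] LocalBanach q :=
  (UniformSpace.Completion.toComplL (𝕜 := ℂ) (E := SeminormSpace q)).toLinearMap

/-- A linear map `T` from a locally convex space to a Banach space is nuclear if
`T x = ∑ c_n f_n(x) y_n` with `∑ |c_n| < ∞`, an equicontinuous sequence of linear functionals `f_n`,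
and `y_n` in the unit ball. -/
def IsNuclearMap [TopologicalSpace E] {F : Type*} [NormedAddCommGroup F] [NormedSpace ℂ F]
    (T : E →ₗ[ℂ] F) : Prop :=
  ∃ (c : ℕ → ℂ) (f : ℕ → E →ₗ[ℂ] ℂ) (y : ℕ → F), (Summable fun n => ‖c n‖) ∧
    (∃ r : Seminorm ℂ E, Continuous r ∧ ∀ n x, ‖f n x‖ ≤ r x) ∧ (∀ n, ‖y n‖ ≤ 1) ∧
    ∀ x, HasSum (fun n => (c n * f n x) • y n) (T x)

/-- A nuclear space: a Hausdorff locally convex space `E` such that for every continuous seminorm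
`q` the canonical map from `E` to the local Banach space of `q` is nuclear. -/
def IsNuclearSpace (E : Type*) [AddCommGroup E] [Module ℂ E] [TopologicalSpace E] : Prop :=
  T2Space E ∧ IsTopologicalAddGroup E ∧ ContinuousSMul ℂ E ∧
  (∀ V ∈ 𝓝 (0 : E), ∃ q : Seminorm ℂ E, Continuous q ∧ q.ball 0 1 ⊆ V) ∧
  ∀ q : Seminorm ℂ E, Continuous q → IsNuclearMap (toLocalBanach q)

end Nuclear

end

/-!
Let `φ` be a limit of test functions on the bounded set `U`. For a function of compact support,
`‖∂^α f‖_∞ ≤ ‖∂^(α + (1, …, 1)) f‖_{L¹}`, so on a set of finite measure the `D^s_{L^p,h}(U)`-norm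
bounds the supremum over `ℝ^d` of every derivative of a test function. Hence the zero extensions of
approximating test functions converge in `C^∞(ℝ^d)`, and their limit is the zero extension of `φ`.
For `p = ∞` the supremum over `U` is the supremum over its closure, and so extension by zero is an
isometry; its range is closed because the space is complete.

For compactness and nuclearity, sample `h^|α| / α!^s * ∂^α φ` on a grid of mesh width comparable to
`A^(-|α|)`, where `A ≥ 2^|s|`. By the mean value theorem these values determine the norm of
`D^{(s)}_{L^∞,h}(U)` up to a factor `2`. On `D^{(s)}_{L^∞,h₁}(U)` they are bounded by
`(h / h₁)^|α|` times the norm, which tends to zero for `h₁ > h`; so the linking map is compact. The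
grid has of order `A^(d|α|)` nodes, so these bounds are summable if `h₁ = 2 A^d h`; then the linking
map followed by the sampling is a nuclear map to `ℓ²`, and the norm of `D^{(s)}_{L^∞,h}(U)` is
bounded through `ℓ²`, where a Hilbert space projection extends maps.
-/

noncomputable section

section NormingFamilies

variable {𝕜 : Type*} [NontriviallyNormedField 𝕜] {X Y : Type*} [NormedAddCommGroup X]
  [NormedSpace 𝕜 X] [NormedAddCommGroup Y] [NormedSpace 𝕜 Y] {κ : Type*}

/-- The functionals `a k` control the norm of `Y`: `‖y‖ ≤ C * sup_k ‖a k y‖`. The supremum enters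
through its upper bounds `D`, so that `k ↦ ‖a k y‖` may be unbounded. -/
def IsNormingFamily (C : ℝ) (a : κ → Y →ₗ[𝕜] 𝕜) : Prop :=
  ∀ ⦃y : Y⦄ ⦃D : ℝ⦄, 0 ≤ D → (∀ k, ‖a k y‖ ≤ D) → ‖y‖ ≤ C * D

/-- Only finitely many of the functionals matter up to a given error, and these take values in a
bounded subset of a finite-dimensional space. -/
theorem IsNormingFamily.totallyBounded [ProperSpace 𝕜] {C : ℝ} {a : κ → Y →ₗ[𝕜] 𝕜}
    (ha : IsNormingFamily C a) {S : Set Y} {b : κ → ℝ} (hS : ∀ y ∈ S, ∀ k, ‖a k y‖ ≤ b k)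
    (hb : Filter.Tendsto b Filter.cofinite (𝓝 0)) : TotallyBounded S := by
  refine Metric.totallyBounded_iff.2 fun ε hε => ?_
  obtain ⟨δ, hδ, hCδ⟩ : ∃ δ > 0, C * δ < ε := by
    refine ⟨ε / (|C| + 1), by positivity, ?_⟩
    rw [mul_div_assoc', div_lt_iff₀ (by positivity)]
    nlinarith [le_abs_self C]
  let K := {k | ¬ b k < δ / 2}
  have hK : K.Finite := hb.eventually_lt_const (half_pos hδ)
  have := hK.fintype
  let Λ : Y →ₗ[𝕜] K → 𝕜 := LinearMap.pi fun k => a k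
  have hΛ : Bornology.IsBounded (Λ '' S) := by
    refine isBounded_iff_forall_norm_le.2 ⟨‖fun k : K => b k‖, ?_⟩
    rintro _ ⟨y, hy, rfl⟩
    exact (pi_norm_le_iff_of_nonneg (norm_nonneg _)).2 fun k =>
      ((hS y hy k).trans (le_abs_self _)).trans (norm_le_pi_norm (fun k : K => b k) k)
  obtain ⟨t, htS, ht, hcover⟩ := Set.exists_subset_image_finite_and.1
    (Metric.finite_approx_of_totallyBounded
      (hΛ.isCompact_closure.totallyBounded.subset subset_closure) δ hδ)
  refine ⟨t, ht, fun y hy => ?_⟩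
  obtain ⟨_, ⟨z, hz, rfl⟩, hyz⟩ := Set.mem_iUnion₂.1 (hcover ⟨y, hy, rfl⟩)
  refine Set.mem_iUnion₂.2 ⟨z, hz, ?_⟩
  rw [mem_ball_iff_norm] at hyz ⊢
  refine (ha hδ.le fun k => ?_).trans_lt hCδ
  rw [map_sub]
  by_cases hk : b k < δ / 2
  · calc ‖a k y - a k z‖ ≤ ‖a k y‖ + ‖a k z‖ := norm_sub_le _ _
      _ ≤ δ := by linarith [hS y hy k, hS z (htS hz) k]
  · exact (norm_le_pi_norm (Λ y - Λ z) ⟨k, hk⟩).trans hyz.le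

theorem IsNormingFamily.isCompactOperator [ProperSpace 𝕜] [CompleteSpace Y] {C : ℝ}
    {a : κ → Y →ₗ[𝕜] 𝕜} (ha : IsNormingFamily C a) {T : X →ₗ[𝕜] Y} {b : κ → ℝ}
    (hb₀ : ∀ k, 0 ≤ b k) (hT : ∀ k x, ‖a k (T x)‖ ≤ b k * ‖x‖)
    (hb : Filter.Tendsto b Filter.cofinite (𝓝 0)) : IsCompactOperator T := by
  rw [isCompactOperator_iff_isCompact_closure_image_ball T one_pos]
  refine ((ha.totallyBounded ?_ hb).closure).isCompact_of_isClosed isClosed_closure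
  rintro _ ⟨x, hx, rfl⟩ k
  exact (hT k x).trans (mul_le_of_le_one_right (hb₀ k) (mem_ball_zero_iff.1 hx).le)

end NormingFamilies

section Nuclear

theorem exists_continuousLinearMap_comp_eq {𝕜 E F H : Type*} [RCLike 𝕜] [AddCommGroup E]
    [Module 𝕜 E] [NormedAddCommGroup F] [NormedSpace 𝕜 F] [CompleteSpace F]
    [NormedAddCommGroup H] [InnerProductSpace 𝕜 H] [CompleteSpace H]
    (J : E →ₗ[𝕜] H) (T : E →ₗ[𝕜] F) {C : ℝ} (hT : ∀ x, ‖T x‖ ≤ C * ‖J x‖) :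
    ∃ A : H →L[𝕜] F, ∀ x, A (J x) = T x := by
  let S : Submodule 𝕜 H := (LinearMap.range J).topologicalClosure
  have : CompleteSpace S := (Submodule.isClosed_topologicalClosure _).completeSpace_coe
  let e : E →ₗ[𝕜] S := J.codRestrict S fun x =>
    Submodule.le_topologicalClosure _ (LinearMap.mem_range_self J x)
  have hdense : DenseRange e := fun y => by
    rw [closure_subtype, ← Set.range_comp]
    exact y.2
  refine ⟨(T.extendOfNorm e).comp S.orthogonalProjectionOnto, fun x => ?_⟩
  have hproj : S.orthogonalProjectionOnto (J x) = e x :=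
    Submodule.orthogonalProjectionOnto_mem_subspace_eq_self (e x)
  rw [ContinuousLinearMap.comp_apply, hproj]
  exact LinearMap.extendOfNorm_eq hdense ⟨C, hT⟩ x

variable {E F : Type*} [AddCommGroup E] [Module ℂ E] [NormedAddCommGroup F] [NormedSpace ℂ F]

theorem norm_toLocalBanach (q : Seminorm ℂ E) (x : E) : ‖toLocalBanach q x‖ = q x :=
  UniformSpace.Completion.norm_coe (E := SeminormSpace q) x

theorem extend_zero_induction {ι β : Type*} [Zero β] {g : ι → ℕ} (hg : Function.Injective g)
    {u : ι → β} {P : β → Prop} (h0 : P 0) (h : ∀ i, P (u i)) (n : ℕ) :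
    P (Function.extend g u 0 n) := by
  by_cases hn : ∃ i, g i = n
  · obtain ⟨i, rfl⟩ := hn
    rw [hg.extend_apply]
    exact h i
  · rwa [Function.extend_apply' _ _ _ hn]

theorem IsNuclearMap.of_countable [TopologicalSpace E] {T : E →ₗ[ℂ] F} {ι : Type*} [Countable ι]
    {c : ι → ℂ} {f : ι → E →ₗ[ℂ] ℂ} {y : ι → F} (hc : Summable fun i => ‖c i‖)
    {r : Seminorm ℂ E} (hr : Continuous r) (hf : ∀ i x, ‖f i x‖ ≤ r x) (hy : ∀ i, ‖y i‖ ≤ 1)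
    (hT : ∀ x, HasSum (fun i => (c i * f i x) • y i) (T x)) : IsNuclearMap T := by
  obtain ⟨g, hg⟩ := exists_injective_nat ι
  have hzero : ∀ {n}, n ∉ Set.range g → Function.extend g c 0 n = 0 :=
    fun hn => Function.extend_apply' _ _ _ hn
  refine ⟨Function.extend g c 0, Function.extend g f 0, Function.extend g y 0, ?_,
    ⟨r, hr, fun n x => ?_⟩, fun n => ?_, fun x => ?_⟩
  · refine (hg.summable_iff fun n hn => by rw [hzero hn, norm_zero]).1 ?_
    simpa only [Function.comp_def, hg.extend_apply] using hc
  · exact extend_zero_induction hg (P := fun f : E →ₗ[ℂ] ℂ => ‖f x‖ ≤ r x) (by simp)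
      (fun i => hf i x) n
  · exact extend_zero_induction hg (P := fun y : F => ‖y‖ ≤ 1) (by simp) hy n
  · refine (hg.hasSum_iff fun n hn => by rw [hzero hn, zero_mul, zero_smul]).1 ?_
    simpa only [Function.comp_def, hg.extend_apply] using hT x

theorem IsNuclearMap.of_hasSum [TopologicalSpace E] {T : E →ₗ[ℂ] F} {ι : Type*} [Countable ι]
    {f : ι → E →ₗ[ℂ] ℂ} {y : ι → F} {b : ι → ℝ} {M : ℝ} (hM : 0 < M) (hb₀ : ∀ i, 0 ≤ b i)
    (hb : Summable b) {r : Seminorm ℂ E} (hr : Continuous r) (hf : ∀ i x, ‖f i x‖ ≤ b i * r x)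
    (hy : ∀ i, ‖y i‖ ≤ M) (hT : ∀ x, HasSum (fun i => f i x • y i) (T x)) : IsNuclearMap T := by
  refine .of_countable (c := fun i => ((M * b i : ℝ) : ℂ)) (f := fun i => (b i : ℂ)⁻¹ • f i)
    (y := fun i => (M : ℂ)⁻¹ • y i) ?_ hr (fun i x => ?_) (fun i => ?_) fun x => ?_
  · simpa only [Complex.norm_real] using (hb.mul_left M).norm
  · rw [LinearMap.smul_apply, norm_smul, norm_inv, Complex.norm_real, Real.norm_of_nonneg (hb₀ i)]
    exact inv_mul_le_of_le_mul₀ (hb₀ i) (apply_nonneg r x) (hf i x)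
  · rw [norm_smul, norm_inv, Complex.norm_real, Real.norm_of_nonneg hM.le]
    exact inv_mul_le_one_of_le₀ (hy i) hM.le
  · convert hT x using 2 with i
    rw [LinearMap.smul_apply, smul_smul, smul_eq_mul]
    congr 1
    rcases eq_or_ne (b i) 0 with hbi | hbi
    · have hfi : f i x = 0 := norm_le_zero_iff.1 <| by simpa [hbi] using hf i x
      simp [hfi]
    · have : (M : ℂ) ≠ 0 := by exact_mod_cast hM.ne'
      have : (b i : ℂ) ≠ 0 := by exact_mod_cast hbi
      push_cast
      field_simp

theorem exists_linearMap_lp {κ : Type*} {p : ENNReal} [Fact (1 ≤ p)] (a : κ → E →ₗ[ℂ] ℂ)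
    (ha : ∀ x, Memℓp (fun k => a k x) p) :
    ∃ J : E →ₗ[ℂ] lp (fun _ : κ => ℂ) p, ∀ x k, J x k = a k x :=
  ⟨{ toFun := fun x => ⟨fun k => a k x, ha x⟩
     map_add' := fun x y => by ext k; exact (a k).map_add x y
     map_smul' := fun c x => by ext k; exact (a k).map_smul c x }, fun _ _ => rfl⟩

/-- The functionals map `E` to `ℓ²`, and the canonical map of `q` factors through `ℓ²`; expanding
along the orthonormal basis of `ℓ²` gives the nuclear representation. -/
theorem isNuclearMap_toLocalBanach [TopologicalSpace E] {κ : Type*} [Countable κ]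
    {q r : Seminorm ℂ E} (hr : Continuous r) {a : κ → E →ₗ[ℂ] ℂ} {b : κ → ℝ}
    (hb₀ : ∀ k, 0 ≤ b k) (hb : Summable b) (hab : ∀ k x, ‖a k x‖ ≤ b k * r x) {C : ℝ}
    (hq : ∀ x D, 0 ≤ D → (∀ k, ‖a k x‖ ≤ D) → q x ≤ C * D) : IsNuclearMap (toLocalBanach q) := by
  classical
  have hmem : ∀ x, Memℓp (fun k => a k x) 2 := fun x =>
    Memℓp.of_exponent_ge (q := 1) (memℓp_gen (by
      simpa using (hb.mul_right (r x)).of_nonneg_of_le (fun _ => norm_nonneg _) fun k => hab k x))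
      one_le_two
  obtain ⟨J, hJ⟩ := exists_linearMap_lp a hmem
  obtain ⟨A, hA⟩ := exists_continuousLinearMap_comp_eq J (toLocalBanach q) (C := C) fun x => by
    rw [norm_toLocalBanach]
    exact hq x _ (norm_nonneg _) fun k => hJ x k ▸ lp.norm_apply_le_norm two_ne_zero (J x) k
  refine IsNuclearMap.of_hasSum (f := a) (y := fun k => A (lp.single 2 k 1)) (M := ‖A‖ + 1)
    (by positivity) hb₀ hb hr hab (fun k => ?_) fun x => ?_
  · have hA₁ := A.le_opNorm (lp.single 2 k (1 : ℂ))
    rw [lp.norm_single (by norm_num), norm_one, mul_one] at hA₁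
    exact hA₁.trans (by linarith)
  · rw [← hA x]
    refine ((lp.hasSum_single (by norm_num) (J x)).map A A.continuous).congr_fun fun k => ?_
    rw [Function.comp_apply, ← map_smul, ← lp.single_smul, smul_eq_mul, mul_one, hJ]

end Nuclear

section ProjectiveLimits

theorem exists_continuous_seminorm_ball_subset {E : Type*} [AddCommGroup E] [Module ℂ E]
    [TopologicalSpace E] [PolynormableSpace ℂ E] {V : Set E} (hV : V ∈ 𝓝 (0 : E)) :
    ∃ q : Seminorm ℂ E, Continuous q ∧ q.ball 0 1 ⊆ V := by
  have hws := PolynormableSpace.withSeminorms ℂ E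
  have := hws.topologicalAddGroup
  obtain ⟨⟨s, r⟩, hr, hV⟩ := hws.hasBasis_zero_ball.mem_iff.1 hV
  refine ⟨r.toNNReal⁻¹ • s.sup fun p => p.1,
    (Seminorm.continuous_finsetSup fun p _ => p.2).const_smul _, fun x hx => hV ?_⟩
  rw [Seminorm.mem_ball_zero, smul_apply, NNReal.smul_def, smul_eq_mul, NNReal.coe_inv,
    Real.coe_toNNReal r hr.le, inv_mul_lt_iff₀ hr, mul_one] at hx
  exact Seminorm.mem_ball_zero _ |>.2 hx

namespace IsTVSProjectiveLimit

variable {ι : Type*} [Preorder ι] {E : Type*} [AddCommGroup E] [Module ℂ E] [TopologicalSpace E]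
  {X : ι → Type*} [∀ i, NormedAddCommGroup (X i)] [∀ i, NormedSpace ℂ (X i)]
  {u : ∀ i j, i ≤ j → (X j →L[ℂ] X i)} {π : ∀ i, E →L[ℂ] X i}

theorem link_proj (hE : IsTVSProjectiveLimit u π) {i j : ι} (hij : i ≤ j) (x : E) :
    u i j hij (π j x) = π i x :=
  hE.range_eq.subset (Set.mem_range_self x) i j hij

theorem comp_cofinal {κ : Type*} [Preorder κ] [IsDirectedOrder κ]
    (hE : IsTVSProjectiveLimit u π) {g : κ → ι} (hg : Monotone g) (hcof : ∀ i, ∃ k, i ≤ g k) :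
    IsTVSProjectiveLimit (fun k l (hkl : k ≤ l) => u (g k) (g l) (hg hkl)) fun k => π (g k) where
  link_refl k := hE.link_refl (g k)
  link_trans k l m hkl hlm := hE.link_trans (g k) (g l) (g m) (hg hkl) (hg hlm)
  isEmbedding := by
    choose k hk using hcof
    let Ψ : (∀ l, X (g l)) → ∀ i, X i := fun y i => u i (g (k i)) (hk i) (y (k i))
    have hΨ : (Ψ ∘ fun x l => π (g l) x) = fun x i => π i x :=
      funext₂ fun x i => hE.link_proj (hk i) x
    exact .of_comp (continuous_pi fun l => (π (g l)).continuous)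
      (continuous_pi fun i => (u i _ (hk i)).continuous.comp (continuous_apply (k i)))
      (hΨ ▸ hE.isEmbedding)
  range_eq := by
    refine subset_antisymm (Set.range_subset_iff.2 fun x k l hkl => hE.link_proj (hg hkl) x) ?_
    intro y hy
    have hindep : ∀ i k l (hk : i ≤ g k) (hl : i ≤ g l),
        u i (g k) hk (y k) = u i (g l) hl (y l) := fun i k l hk hl => by
      obtain ⟨m, hkm, hlm⟩ := exists_ge_ge k l
      rw [← hy k m hkm, ← hy l m hlm, hE.link_trans, hE.link_trans]
    choose k hk using hcof
    obtain ⟨x, hx⟩ := hE.range_eq.superset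
      (show (fun i => u i (g (k i)) (hk i) (y (k i))) ∈ _ from fun i j hij => by
        rw [hE.link_trans]
        exact hindep i (k j) (k i) (hij.trans (hk j)) (hk i))
    refine ⟨x, funext fun l => ?_⟩
    rw [congrFun hx (g l), hindep (g l) (k (g l)) l (hk (g l)) le_rfl, hE.link_refl]

theorem polynormableSpace (hE : IsTVSProjectiveLimit u π) : PolynormableSpace ℂ E :=
  IsInducing.polynormableSpace (f := LinearMap.pi fun i => (π i).toLinearMap)
    hE.isEmbedding.isInducing

theorem exists_seminorm_le [IsDirectedOrder ι] [Nonempty ι] (hE : IsTVSProjectiveLimit u π)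
    {q : Seminorm ℂ E} (hq : Continuous q) : ∃ i C, 0 ≤ C ∧ ∀ x, q x ≤ C * ‖π i x‖ := by
  classical
  obtain ⟨s, C, -, hqC⟩ := Seminorm.bound_comp_of_isInducing hq
    (withSeminorms_pi fun i => norm_withSeminorms ℂ (X i))
    (f := LinearMap.pi fun i => (π i).toLinearMap) hE.isEmbedding.isInducing
  obtain ⟨i, hi⟩ := (s.image Sigma.fst).exists_le
  have hsi : ∀ k ∈ s, ∃ M, 0 ≤ M ∧ ∀ x, ‖π k.1 x‖ ≤ M * ‖π i x‖ := fun k hk => by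
    have hki := hi k.1 (Finset.mem_image_of_mem _ hk)
    refine ⟨‖u k.1 i hki‖, norm_nonneg _, fun x => ?_⟩
    rw [← hE.link_proj hki x]
    exact (u k.1 i hki).le_opNorm _
  choose! M hM₀ hM using hsi
  refine ⟨i, C * ∑ k ∈ s, M k, mul_nonneg C.2 (Finset.sum_nonneg hM₀), fun x => ?_⟩
  rw [mul_assoc]
  refine (hqC x).trans (mul_le_mul_of_nonneg_left ?_ C.2)
  refine Seminorm.finset_sup_apply_le
    (mul_nonneg (Finset.sum_nonneg hM₀) (norm_nonneg _)) fun k hk => (hM k hk x).trans ?_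
  gcongr
  exact Finset.single_le_sum hM₀ hk

theorem isNuclearSpace [IsDirectedOrder ι] [Nonempty ι] (hE : IsTVSProjectiveLimit u π)
    (H : ∀ i, ∃ (j : ι) (hij : i ≤ j) (κ : Type*) (_ : Countable κ) (a : κ → X i →ₗ[ℂ] ℂ)
      (C : ℝ) (b : κ → ℝ), IsNormingFamily C a ∧ (∀ k, 0 ≤ b k) ∧ Summable b ∧
        ∀ k x, ‖a k (u i j hij x)‖ ≤ b k * ‖x‖) : IsNuclearSpace E := by
  have hpoly := hE.polynormableSpace
  have hws := PolynormableSpace.withSeminorms ℂ E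
  refine ⟨hE.isEmbedding.t2Space, hws.topologicalAddGroup, hws.continuousSMul,
    fun V hV => exists_continuous_seminorm_ball_subset hV, fun q hq => ?_⟩
  obtain ⟨i, C, hC, hqC⟩ := hE.exists_seminorm_le hq
  obtain ⟨j, hij, κ, _, a, C', b, ha, hb₀, hb, hab⟩ := H i
  refine isNuclearMap_toLocalBanach
    (r := (normSeminorm ℂ (X j)).comp (π j).toLinearMap) (π j).continuous.norm
    (a := fun k => (a k).comp (π i).toLinearMap) hb₀ hb (fun k x => ?_) (C := C * C')
    fun x D hD hx => ?_
  · rw [LinearMap.comp_apply, ContinuousLinearMap.coe_coe, ← hE.link_proj hij]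
    exact hab k (π j x)
  · rw [mul_assoc]
    exact (hqC x).trans (mul_le_mul_of_nonneg_left (ha hD hx) hC)

end IsTVSProjectiveLimit

end ProjectiveLimits

namespace Gevrey

section DirectionalDerivatives

variable {𝕜 E F ι : Type*} [RCLike 𝕜] [NormedAddCommGroup E] [NormedSpace 𝕜 E]
  [NormedAddCommGroup F] [NormedSpace 𝕜 F]

/-- The iterated derivative of `f` in the directions `v i`, where `i` runs through the list `l`. -/
def iterDirDeriv (v : ι → E) (l : List ι) (f : E → F) (x : E) : F :=
  iteratedFDeriv 𝕜 l.length f x fun i => v (l.get i)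

theorem iterDirDeriv_cons {f : E → F} (hf : ContDiff 𝕜 ∞ f) (v : ι → E) (i : ι) (l : List ι)
    (x : E) :
    iterDirDeriv (𝕜 := 𝕜) v (i :: l) f x = fderiv 𝕜 (iterDirDeriv (𝕜 := 𝕜) v l f) x (v i) := by
  have hd : DifferentiableAt 𝕜 (iteratedFDeriv 𝕜 l.length f) x :=
    hf.differentiable_iteratedFDeriv (by exact_mod_cast ENat.natCast_lt_top _) x
  exact (iteratedFDeriv_succ_apply_left _).trans
    (fderiv_continuousMultilinear_apply_const_apply hd _ _).symm

theorem contDiff_iterDirDeriv {f : E → F} (hf : ContDiff 𝕜 ∞ f) (v : ι → E) (l : List ι) :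
    ContDiff 𝕜 ∞ (iterDirDeriv (𝕜 := 𝕜) v l f) := by
  induction l with
  | nil => exact hf
  | cons i l ih =>
    rw [funext (iterDirDeriv_cons hf v i l)]
    exact (ih.fderiv_right (m := ∞) (by simp)).clm_apply contDiff_const

theorem fderiv_fderiv_apply_comm {f : E → F} (hf : ContDiff 𝕜 ∞ f) (v w x : E) :
    fderiv 𝕜 (fun y => fderiv 𝕜 f y v) x w = fderiv 𝕜 (fun y => fderiv 𝕜 f y w) x v := by
  have hd : DifferentiableAt 𝕜 (fderiv 𝕜 f) x :=
    (hf.fderiv_right (m := ∞) (by simp)).differentiable (by simp) x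
  have hs : IsSymmSndFDerivAt 𝕜 f x :=
    hf.contDiffAt.isSymmSndFDerivAt
      (by simpa using WithTop.coe_le_coe.2 (le_top : (2 : ℕ∞) ≤ ⊤))
  rw [fderiv_clm_apply hd (differentiableAt_const v),
    fderiv_clm_apply hd (differentiableAt_const w)]
  simpa using hs w v

theorem iterDirDeriv_congr_perm {f : E → F} (hf : ContDiff 𝕜 ∞ f) (v : ι → E) {l l' : List ι}
    (h : l.Perm l') : iterDirDeriv (𝕜 := 𝕜) v l f = iterDirDeriv (𝕜 := 𝕜) v l' f := by
  induction h with
  | nil => rfl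
  | cons i _ ih => rw [funext (iterDirDeriv_cons hf v i _), funext (iterDirDeriv_cons hf v i _), ih]
  | swap i j l =>
    funext x
    simp only [iterDirDeriv_cons hf, funext (iterDirDeriv_cons hf v _ l)]
    exact fderiv_fderiv_apply_comm (contDiff_iterDirDeriv hf v l) _ _ x
  | trans _ _ h₁ h₂ => exact h₁.trans h₂

theorem iterDirDeriv_ofFn (v : ι → E) {k : ℕ} (r : Fin k → ι) (f : E → F) (x : E) :
    iterDirDeriv (𝕜 := 𝕜) v (List.ofFn r) f x = iteratedFDeriv 𝕜 k f x fun i => v (r i) := by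
  have key : ∀ (n : ℕ) (hn : n = k) (g : Fin n → ι), (∀ i, g i = r (Fin.cast hn i)) →
      iteratedFDeriv 𝕜 n f x (fun i => v (g i)) = iteratedFDeriv 𝕜 k f x fun i => v (r i) := by
    rintro n rfl g hg
    simp only [hg, Fin.cast_eq_self]
  exact key _ List.length_ofFn _ fun i => List.get_ofFn r i

end DirectionalDerivatives

section OrthonormalBasis

variable {𝕜 E F ι : Type*} [RCLike 𝕜] [NormedAddCommGroup E] [InnerProductSpace 𝕜 E]
  [NormedAddCommGroup F] [NormedSpace 𝕜 F] [Fintype ι] (b : OrthonormalBasis ι 𝕜 E)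

theorem norm_repr_apply_le (v : E) (i : ι) : ‖b.repr v i‖ ≤ ‖v‖ :=
  (PiLp.norm_apply_le _ i).trans (b.repr.norm_map v).le

theorem norm_clm_le_sum_basis (T : E →L[𝕜] F) : ‖T‖ ≤ ∑ i, ‖T (b i)‖ := by
  refine T.opNorm_le_bound (by positivity) fun v => ?_
  conv_lhs => rw [← b.sum_repr v, map_sum]
  rw [Finset.sum_mul]
  refine (norm_sum_le _ _).trans (Finset.sum_le_sum fun i _ => ?_)
  rw [map_smul, norm_smul, mul_comm]
  gcongr
  exact norm_repr_apply_le b v i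

theorem norm_multilinear_le_sum_basis {k : ℕ}
    (m : ContinuousMultilinearMap 𝕜 (fun _ : Fin k => E) F) :
    ‖m‖ ≤ ∑ r : Fin k → ι, ‖m fun i => b (r i)‖ := by
  classical
  refine ContinuousMultilinearMap.opNorm_le_bound (by positivity) fun v => ?_
  have expand : m v = ∑ r : Fin k → ι, m fun i => b.repr (v i) (r i) • b (r i) := by
    have := m.map_sum (α := fun _ => ι) (g := fun i j => b.repr (v i) j • b j)
    simpa only [b.sum_repr] using this
  rw [expand, Finset.sum_mul]
  refine (norm_sum_le _ _).trans (Finset.sum_le_sum fun r _ => ?_)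
  rw [m.map_smul_univ, norm_smul, mul_comm, norm_prod]
  gcongr with i
  exact norm_repr_apply_le b (v i) (r i)

end OrthonormalBasis

section PartialDerivatives

variable {d : ℕ}

/-- The standard orthonormal basis of `ℝ^d`. -/
abbrev stdBasis (d : ℕ) : OrthonormalBasis (Fin d) ℝ (Eu d) := EuclideanSpace.basisFun (Fin d) ℝ

theorem pderiv_eq_iterDirDeriv (α : Fin d → ℕ) (f : Eu d → ℂ) :
    pderiv α f = iterDirDeriv (𝕜 := ℝ) (stdBasis d) (dirs α) f := by
  funext x
  simp only [pderiv, iterDirDeriv, EuclideanSpace.basisFun_apply]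

theorem iterDirDeriv_stdBasis {f : Eu d → ℂ} (hf : ContDiff ℝ ∞ f) (l : List (Fin d)) :
    iterDirDeriv (𝕜 := ℝ) (stdBasis d) l f = pderiv (fun j => l.count j) f := by
  rw [pderiv_eq_iterDirDeriv]
  exact iterDirDeriv_congr_perm hf _ (List.perm_iff_count.2 fun j =>
    (count_dirs (fun j => l.count j) j).symm)

theorem contDiff_pderiv {f : Eu d → ℂ} (hf : ContDiff ℝ ∞ f) (α : Fin d → ℕ) :
    ContDiff ℝ ∞ (pderiv α f) := by
  rw [pderiv_eq_iterDirDeriv]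
  exact contDiff_iterDirDeriv hf _ _

theorem fderiv_pderiv {f : Eu d → ℂ} (hf : ContDiff ℝ ∞ f) (α : Fin d → ℕ) (j : Fin d)
    (x : Eu d) : fderiv ℝ (pderiv α f) x (stdBasis d j) = pderiv (α + Pi.single j 1) f x := by
  rw [pderiv_eq_iterDirDeriv, ← iterDirDeriv_cons hf, iterDirDeriv_stdBasis hf]
  congr 1
  funext i
  rw [List.count_cons, count_dirs, Pi.add_apply, Pi.single_apply]
  simp only [beq_iff_eq, eq_comm (a := i)]

theorem norm_iteratedFDeriv_le_sum_pderiv {f : Eu d → ℂ} (hf : ContDiff ℝ ∞ f) (k : ℕ)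
    (x : Eu d) :
    ‖iteratedFDeriv ℝ k f x‖ ≤
      ∑ r : Fin k → Fin d, ‖pderiv (fun j => (List.ofFn r).count j) f x‖ := by
  simpa only [← iterDirDeriv_stdBasis hf, iterDirDeriv_ofFn] using
    norm_multilinear_le_sum_basis (stdBasis d) (iteratedFDeriv ℝ k f x)

theorem norm_pderiv_sub_le {f : Eu d → ℂ} (hf : ContDiff ℝ ∞ f) (α : Fin d → ℕ) {C : ℝ}
    (hC : ∀ j x, ‖pderiv (α + Pi.single j 1) f x‖ ≤ C) (x y : Eu d) :
    ‖pderiv α f x - pderiv α f y‖ ≤ d * C * ‖x - y‖ := by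
  refine Convex.norm_image_sub_le_of_norm_fderiv_le (s := Set.univ) (𝕜 := ℝ)
    (fun z _ => (contDiff_pderiv hf α).differentiable (by simp) z) (fun z _ => ?_) convex_univ
    trivial trivial
  calc ‖fderiv ℝ (pderiv α f) z‖ ≤ ∑ j, ‖fderiv ℝ (pderiv α f) z (stdBasis d j)‖ :=
        norm_clm_le_sum_basis _ _
    _ ≤ ∑ _j : Fin d, C := Finset.sum_le_sum fun j _ => (fderiv_pderiv hf α j z).symm ▸ hC j z
    _ = d * C := by simp

theorem pderiv_sub (α : Fin d → ℕ) {f g : Eu d → ℂ} {x : Eu d}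
    (hf : ContDiffAt ℝ ∞ f x) (hg : ContDiffAt ℝ ∞ g x) :
    pderiv α (f - g) x = pderiv α f x - pderiv α g x := by
  have hg' : ContDiffAt ℝ ∞ ((-1 : ℂ) • g) x := ContDiffAt.const_smul (-1 : ℂ) hg
  have hfg : f - g = f + (-1 : ℂ) • g := by simp [sub_eq_add_neg]
  rw [hfg, pderiv_add α hf hg', pderiv_smul α _ hg]
  ring

theorem pderiv_eq_zero_of_notMem_tsupport {f : Eu d → ℂ} {x : Eu d} (hx : x ∉ tsupport f)
    (α : Fin d → ℕ) : pderiv α f x = 0 := by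
  have hz : iteratedFDeriv ℝ (dirs α).length f x = 0 :=
    image_eq_zero_of_notMem_tsupport fun h => hx (tsupport_iteratedFDeriv_subset _ h)
  simp [pderiv, hz]

theorem hasCompactSupport_pderiv {f : Eu d → ℂ} (hf : HasCompactSupport f) (α : Fin d → ℕ) :
    HasCompactSupport (pderiv α f) :=
  hf.mono' fun _ hx => by_contra fun h => hx (pderiv_eq_zero_of_notMem_tsupport h α)

theorem hasSum_pderiv_tsum {ι : Type*} {f : ι → Eu d → ℂ} (hf : ∀ n, ContDiff ℝ ∞ (f n))
    {M : (Fin d → ℕ) → ι → ℝ} (hM : ∀ α, Summable (M α))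
    (hfM : ∀ α n x, ‖pderiv α (f n) x‖ ≤ M α n) :
    ContDiff ℝ ∞ (fun x => ∑' n, f n x) ∧
      ∀ α x, HasSum (fun n => pderiv α (f n) x) (pderiv α (fun y => ∑' n, f n y) x) := by
  have hv : ∀ k : ℕ, (k : ℕ∞) ≤ (⊤ : ℕ∞) → Summable fun n => ∑ r : Fin k → Fin d,
      M (fun j => (List.ofFn r).count j) n := fun k _ => summable_sum fun r _ => hM _
  have hb : ∀ (k : ℕ) (n : ι) (x : Eu d), (k : ℕ∞) ≤ (⊤ : ℕ∞) → ‖iteratedFDeriv ℝ k (f n) x‖ ≤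
      ∑ r : Fin k → Fin d, M (fun j => (List.ofFn r).count j) n := fun k n x _ =>
    (norm_iteratedFDeriv_le_sum_pderiv (hf n) k x).trans (Finset.sum_le_sum fun r _ => hfM _ _ _)
  refine ⟨contDiff_tsum hf hv hb, fun α x => ?_⟩
  refine ContinuousMultilinearMap.hasSum_eval ?_ _
  rw [iteratedFDeriv_tsum_apply hf hv hb le_top]
  exact ((hv (dirs α).length le_top).of_norm_bounded fun n => hb _ n x le_top).hasSum

theorem exists_contDiff_tendsto_pderiv {f : ℕ → Eu d → ℂ} (hf : ∀ n, ContDiff ℝ ∞ (f n))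
    {M : (Fin d → ℕ) → ℕ → ℝ} (hM : ∀ α, Summable (M α))
    (hfM : ∀ α n x, ‖pderiv α (f (n + 1)) x - pderiv α (f n) x‖ ≤ M α n) :
    ∃ F : Eu d → ℂ, ContDiff ℝ ∞ F ∧
      ∀ α x, Filter.Tendsto (fun n => pderiv α (f n) x) Filter.atTop (𝓝 (pderiv α F x)) := by
  have hsub : ∀ α n x, pderiv α (f (n + 1) - f n) x = pderiv α (f (n + 1)) x - pderiv α (f n) x :=
    fun α n x => pderiv_sub α (hf (n + 1)).contDiffAt (hf n).contDiffAt
  obtain ⟨hG, hsum⟩ := hasSum_pderiv_tsum (f := fun n => f (n + 1) - f n)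
    (fun n => (hf (n + 1)).sub (hf n)) hM fun α n x => (hsub α n x).symm ▸ hfM α n x
  refine ⟨f 0 + fun x => ∑' n, (f (n + 1) - f n) x, (hf 0).add hG, fun α x => ?_⟩
  have hlim := ((hsum α x).tendsto_sum_nat).const_add (pderiv α (f 0) x)
  simp only [hsub, Finset.sum_range_sub (fun n => pderiv α (f n) x), add_sub_cancel] at hlim
  rwa [pderiv_add α (hf 0).contDiffAt hG.contDiffAt]

end PartialDerivatives

section AlmostEverywhere

variable {X : Type*} [TopologicalSpace X] [MeasurableSpace X]
  {μ : Measure X} [μ.IsOpenPosMeasure] {U : Set X}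

theorem eLpNorm_top_restrict_eq_iSup_closure [OpensMeasurableSpace X] {F : Type*}
    [NormedAddCommGroup F] (hU : IsOpen U) {g : X → F} (hg : Continuous g) :
    eLpNorm g ⊤ (μ.restrict U) = ⨆ x ∈ closure U, ‖g x‖ₑ := by
  rw [eLpNorm_exponent_top]
  refine le_antisymm (essSup_le_of_ae_le _ ?_) (iSup₂_le ?_)
  · filter_upwards [ae_restrict_mem hU.measurableSet] with x hx
    exact le_iSup₂ (f := fun x (_ : x ∈ closure U) => ‖g x‖ₑ) x (subset_closure hx)
  · have hdense : Dense {x | x ∈ U → ‖g x‖ₑ ≤ eLpNormEssSup g (μ.restrict U)} :=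
      Measure.dense_of_ae ((ae_restrict_iff' hU.measurableSet).1 ae_le_eLpNormEssSup)
    exact closure_minimal ((hdense.open_subset_closure_inter hU).trans
      (closure_minimal (fun y hy => hy.2 hy.1) (isClosed_le hg.enorm continuous_const)))
      (isClosed_le hg.enorm continuous_const)

theorem eqOn_of_tendsto_of_tendsto_eLpNorm {F : Type*} [NormedAddCommGroup F] (hU : IsOpen U)
    {p : ENNReal} (hp : p ≠ 0) {f : ℕ → X → F} {g g' : X → F}
    (hf : ∀ n, AEStronglyMeasurable (f n) (μ.restrict U))
    (hg' : AEStronglyMeasurable g' (μ.restrict U))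
    (hgc : ContinuousOn g U) (hgc' : ContinuousOn g' U)
    (hfg : ∀ x, Filter.Tendsto (fun n => f n x) Filter.atTop (𝓝 (g x)))
    (hfg' : Filter.Tendsto (fun n => eLpNorm (f n - g') p (μ.restrict U)) Filter.atTop (𝓝 0)) :
    Set.EqOn g g' U := by
  obtain ⟨ns, hns, hae⟩ :=
    (tendstoInMeasure_of_tendsto_eLpNorm hp hf hg' hfg').exists_seq_tendsto_ae
  refine Measure.eqOn_open_of_ae_eq (μ := μ) ?_ hU hgc hgc'
  filter_upwards [hae] with x hx
  exact tendsto_nhds_unique ((hfg x).comp hns.tendsto_atTop) hx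

end AlmostEverywhere

theorem exists_seq_of_mem_closure {E : Type*} [SeminormedAddCommGroup E] {S : Set E} {a : E}
    (ha : a ∈ closure S) : ∃ t : ℕ → E, (∀ n, t n ∈ S) ∧ Filter.Tendsto t Filter.atTop (𝓝 a) ∧
      ∀ n, ‖t (n + 1) - t n‖ ≤ 2 * (1 / 2) ^ n := by
  have approx : ∀ n : ℕ, ∃ t ∈ S, dist a t < (1 / 2) ^ n := fun n =>
    Metric.mem_closure_iff.1 ha _ (by positivity)
  choose t htS hta using approx
  have hta' : ∀ n, ‖t n - a‖ ≤ (1 / 2) ^ n := fun n => by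
    rw [← dist_eq_norm, dist_comm]
    exact (hta n).le
  refine ⟨t, htS, tendsto_iff_norm_sub_tendsto_zero.2 (squeeze_zero (fun _ => norm_nonneg _) hta'
    (tendsto_pow_atTop_nhds_zero_of_lt_one (by norm_num) (by norm_num))), fun n => ?_⟩
  calc ‖t (n + 1) - t n‖ ≤ ‖t (n + 1) - a‖ + ‖t n - a‖ := by
        simpa only [sub_sub_sub_cancel_right] using norm_sub_le (t (n + 1) - a) (t n - a)
    _ ≤ (1 / 2) ^ n + (1 / 2) ^ n := by
        gcongr
        · exact (hta' (n + 1)).trans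
            (pow_le_pow_of_le_one (by norm_num) (by norm_num) n.le_succ)
        · exact hta' n
    _ = 2 * (1 / 2) ^ n := by ring

section Sobolev

variable {d : ℕ}

theorem contDiff_toLp_update (i : Fin d) (x : Fin d → ℝ) :
    ContDiff ℝ ∞ fun t : ℝ => (WithLp.toLp 2 (Function.update x i t) : Eu d) :=
  (PiLp.continuousLinearEquiv 2 ℝ fun _ : Fin d => ℝ).symm.contDiff.comp (contDiff_update ∞ x i)

theorem deriv_comp_toLp_update {g : Eu d → ℂ} (hg : Differentiable ℝ g) (i : Fin d)
    (x : Fin d → ℝ) (t : ℝ) :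
    deriv (fun t => g (WithLp.toLp 2 (Function.update x i t))) t =
      fderiv ℝ g (WithLp.toLp 2 (Function.update x i t)) (stdBasis d i) := by
  have hline : HasDerivAt (fun t : ℝ => (WithLp.toLp 2 (Function.update x i t) : Eu d))
      (stdBasis d i) t := by
    rw [EuclideanSpace.basisFun_apply]
    exact (PiLp.continuousLinearEquiv 2 ℝ fun _ : Fin d => ℝ).symm.hasFDerivAt.comp_hasDerivAt t
      (hasDerivAt_update x i t)
  exact ((hg _).hasFDerivAt.comp_hasDerivAt t hline).deriv

theorem hasCompactSupport_comp_toLp_update {g : Eu d → ℂ} (hg : HasCompactSupport g) (i : Fin d)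
    (x : Fin d → ℝ) :
    HasCompactSupport fun t => g (WithLp.toLp 2 (Function.update x i t)) :=
  hg.comp_isClosedEmbedding
    ((PiLp.homeomorph 2 fun _ : Fin d => ℝ).symm.isClosedEmbedding.comp
      (isClosedEmbedding_update x i))

theorem enorm_pderiv_le_lmarginal {f : Eu d → ℂ} (hf : ContDiff ℝ ∞ f) (hc : HasCompactSupport f)
    (S : Finset (Fin d)) (α : Fin d → ℕ) (x : Fin d → ℝ) :
    ‖pderiv α f (WithLp.toLp 2 x)‖ₑ ≤
      (∫⋯∫⁻_S, (fun y => ‖pderiv (α + ∑ i ∈ S, Pi.single i 1) f (WithLp.toLp 2 y)‖ₑ)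
        ∂(fun _ => volume)) x := by
  induction S using Finset.induction_on generalizing α x with
  | empty => simp
  | insert i S hi ih =>
    have hm : Measurable fun y : Fin d → ℝ =>
        ‖pderiv (α + ∑ i ∈ insert i S, Pi.single i 1) f (WithLp.toLp 2 y)‖ₑ :=
      ((contDiff_pderiv hf _).continuous.comp
        (PiLp.continuous_toLp 2 fun _ : Fin d => ℝ)).enorm.measurable
    have ftc := HasCompactSupport.enorm_le_lintegral_Ici_deriv
      (((contDiff_pderiv hf α).comp (contDiff_toLp_update i x)).of_le (by exact_mod_cast le_top))
      (hasCompactSupport_comp_toLp_update (hasCompactSupport_pderiv hc α) i x) (x i)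
    rw [Function.comp_apply, Function.update_eq_self] at ftc
    rw [lmarginal_insert _ hm hi]
    refine ftc.trans ((setLIntegral_le_lintegral _ _).trans (lintegral_mono fun t => ?_))
    rw [Function.comp_def,
      deriv_comp_toLp_update ((contDiff_pderiv hf α).differentiable (by simp)) i x t,
      fderiv_pderiv hf, Finset.sum_insert hi, ← add_assoc]
    exact ih _ _

theorem enorm_pderiv_le_lintegral {f : Eu d → ℂ} (hf : ContDiff ℝ ∞ f) (hc : HasCompactSupport f)
    (α : Fin d → ℕ) (x : Eu d) : ‖pderiv α f x‖ₑ ≤ ∫⁻ y, ‖pderiv (α + 1) f y‖ₑ := by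
  have h := enorm_pderiv_le_lmarginal hf hc Finset.univ α x.ofLp
  have hone : ∑ i : Fin d, Pi.single i (1 : ℕ) = (1 : Fin d → ℕ) :=
    Finset.univ_sum_single (1 : Fin d → ℕ)
  rw [hone, lmarginal_univ] at h
  exact h.trans_eq <| (PiLp.volume_preserving_toLp (Fin d)).lintegral_comp
    (f := fun y => ‖pderiv (α + 1) f y‖ₑ) (contDiff_pderiv hf _).continuous.enorm.measurable

end Sobolev

section ExtensionByZero

variable {d : ℕ} {s : ℝ} {p : ENNReal} {U : Opens (Eu d)}

theorem zeroExt_of_mem (φ : U → ℂ) {x : Eu d} (hx : x ∈ U) : zeroExt U φ x = φ ⟨x, hx⟩ := by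
  simp [zeroExt, hx]

theorem zeroExt_of_notMem (φ : U → ℂ) {x : Eu d} (hx : x ∉ U) : zeroExt U φ x = 0 := by
  simp [zeroExt, hx]

theorem zeroExt_injective : Function.Injective (zeroExt U) := fun φ ψ h =>
  funext fun x => by simpa [zeroExt] using congrFun h x

theorem zeroExt_sub (φ ψ : U → ℂ) : zeroExt U (φ - ψ) = zeroExt U φ - zeroExt U ψ := by
  funext x; by_cases hx : x ∈ U <;> simp [zeroExt, hx]

theorem tsupport_zeroExt_subset (φ : U → ℂ) : tsupport (zeroExt U φ) ⊆ closure (U : Set (Eu d)) :=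
  closure_mono fun _ hx => by_contra fun h => hx (zeroExt_of_notMem φ h)

theorem exists_contDiff_zeroExt_tendsto_pderiv {f : ℕ → U → ℂ}
    (hf : ∀ n, ContDiff ℝ ∞ (zeroExt U (f n))) {M : (Fin d → ℕ) → ℕ → ℝ}
    (hM : ∀ α, Summable (M α)) (hfM : ∀ α n x,
      ‖pderiv α (zeroExt U (f (n + 1))) x - pderiv α (zeroExt U (f n)) x‖ ≤ M α n) :
    ∃ g : U → ℂ, ContDiff ℝ ∞ (zeroExt U g) ∧ ∀ α x, Filter.Tendsto
      (fun n => pderiv α (zeroExt U (f n)) x) Filter.atTop (𝓝 (pderiv α (zeroExt U g) x)) := by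
  obtain ⟨F, hF, hlim⟩ := exists_contDiff_tendsto_pderiv hf hM hfM
  have hFU : zeroExt U (fun x => F x) = F := funext fun x => by
    by_cases hx : x ∈ U
    · exact zeroExt_of_mem _ hx
    · have hlim₀ := hlim 0 x
      simp only [pderiv_zero, zeroExt_of_notMem _ hx] at hlim₀
      exact (zeroExt_of_notMem _ hx).trans (tendsto_nhds_unique tendsto_const_nhds hlim₀)
  exact ⟨fun x => F x, hFU.symm ▸ hF, hFU.symm ▸ hlim⟩

theorem contDiff_zeroExt_of_mem_testSubmodule {φ : U → ℂ} (hφ : φ ∈ testSubmodule s U) :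
    ContDiff ℝ ∞ (zeroExt U φ) := by
  obtain ⟨K, -, -, h⟩ := hφ
  exact ((Submodule.mem_iInf _).1 h ⟨1, Set.mem_Ioi.2 one_pos⟩).1

theorem hasCompactSupport_tsupport_subset_of_mem_testSubmodule {φ : U → ℂ}
    (hφ : φ ∈ testSubmodule s U) :
    HasCompactSupport (zeroExt U φ) ∧ tsupport (zeroExt U φ) ⊆ U := by
  obtain ⟨K, hK, hKU, h⟩ := hφ
  have hsupp := ((Submodule.mem_iInf _).1 h ⟨1, Set.mem_Ioi.2 one_pos⟩).2.1
  exact ⟨hK.of_isClosed_subset (isClosed_tsupport _) hsupp, hsupp.trans hKU⟩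

theorem weight_zero (s h : ℝ) : weight s h (0 : Fin d → ℕ) = 1 := by simp [weight]

theorem weight_mul_derivENorm_le_lpENorm (hp : 1 ≤ p) (h : ℝ) (φ : U → ℂ) (α : Fin d → ℕ) :
    ENNReal.ofReal (weight s h α) * derivENorm p U φ α ≤ lpENorm s p h U φ := by
  unfold lpENorm
  split_ifs with hpt
  · exact le_iSup (fun α => ENNReal.ofReal (weight s h α) * derivENorm p U φ α) α
  · rw [one_div, ENNReal.le_rpow_inv_iff (ENNReal.toReal_pos (one_pos.trans_le hp).ne' hpt)]
    exact ENNReal.le_tsum (f := fun α => (ENNReal.ofReal (weight s h α) *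
      derivENorm p U φ α) ^ p.toReal) α

variable [hp : Fact (1 ≤ p)] {h : Set.Ioi (0 : ℝ)}

theorem LpSpace.lpENorm_fn (φ : LpSpace s p h U) :
    lpENorm s p h.1 U φ.fn = ENNReal.ofReal ‖φ‖ :=
  (ENNReal.ofReal_toReal φ.2.2.ne).symm

theorem LpSpace.derivENorm_le (φ : LpSpace s p h U) (α : Fin d → ℕ) :
    derivENorm p U φ.fn α ≤ ENNReal.ofReal (‖φ‖ / weight s h.1 α) := by
  have hw := weight_pos s h.2 α
  rw [ENNReal.ofReal_div_of_pos hw, ENNReal.le_div_iff_mul_le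
    (Or.inl (ENNReal.ofReal_pos.2 hw).ne') (Or.inl ENNReal.ofReal_ne_top), mul_comm,
    ← φ.lpENorm_fn]
  exact weight_mul_derivENorm_le_lpENorm hp.out h.1 φ.fn α

theorem LpSpace.eLpNorm_zeroExt_le (φ : LpSpace s p h U) :
    eLpNorm (zeroExt U φ.fn) p (volume.restrict (U : Set (Eu d))) ≤ ENNReal.ofReal ‖φ‖ := by
  simpa only [derivENorm, pderiv_zero, weight_zero, div_one] using φ.derivENorm_le 0

theorem LpSpace.tendsto_eLpNorm_zeroExt_sub {t : ℕ → LpSpace s p h U} {φ : LpSpace s p h U}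
    (ht : Filter.Tendsto t Filter.atTop (𝓝 φ)) :
    Filter.Tendsto (fun n => eLpNorm (zeroExt U (t n).fn - zeroExt U φ.fn) p
      (volume.restrict (U : Set (Eu d)))) Filter.atTop (𝓝 0) := by
  have hnorm := ENNReal.tendsto_ofReal (tendsto_iff_norm_sub_tendsto_zero.1 ht)
  rw [ENNReal.ofReal_zero] at hnorm
  refine tendsto_of_tendsto_of_tendsto_of_le_of_le tendsto_const_nhds hnorm
    (fun _ => zero_le) fun n => ?_
  simp only [← zeroExt_sub]
  exact (t n - φ).eLpNorm_zeroExt_le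

/-- The derivatives of all test functions on `U` are bounded by their `D^s_{L^p,h}(U)`-norm. -/
def HasDerivBounds (s : ℝ) (p : ENNReal) [Fact (1 ≤ p)] (h : Set.Ioi (0 : ℝ))
    (U : Opens (Eu d)) : Prop :=
  ∃ C : (Fin d → ℕ) → ℝ, ∀ φ : LpSpace s p h U, φ.fn ∈ testSubmodule s U → ∀ α x,
    ‖pderiv α (zeroExt U φ.fn) x‖ ≤ C α * ‖φ‖

theorem enorm_pderiv_zeroExt_le_derivENorm_top {φ : U → ℂ} (hφ : ContDiff ℝ ∞ (zeroExt U φ))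
    (α : Fin d → ℕ) (x : Eu d) : ‖pderiv α (zeroExt U φ) x‖ₑ ≤ derivENorm ⊤ U φ α := by
  by_cases hx : x ∈ closure (U : Set (Eu d))
  · rw [derivENorm, eLpNorm_top_restrict_eq_iSup_closure U.isOpen (contDiff_pderiv hφ α).continuous]
    exact le_iSup₂ (f := fun x (_ : x ∈ closure (U : Set (Eu d))) =>
      ‖pderiv α (zeroExt U φ) x‖ₑ) x hx
  · simp [pderiv_eq_zero_of_notMem_tsupport fun h => hx (tsupport_zeroExt_subset φ h)]

theorem LpSpace.weight_mul_norm_pderiv_le {φ : LpSpace s ⊤ h U}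
    (hφ : ContDiff ℝ ∞ (zeroExt U φ.fn)) (α : Fin d → ℕ) (x : Eu d) :
    weight s h.1 α * ‖pderiv α (zeroExt U φ.fn) x‖ ≤ ‖φ‖ := by
  have hw := weight_pos s h.2 α
  rw [← le_div_iff₀' hw, ← ENNReal.ofReal_le_ofReal_iff (by positivity), ofReal_norm]
  exact (enorm_pderiv_zeroExt_le_derivENorm_top hφ α x).trans (φ.derivENorm_le α)

theorem hasDerivBounds_top (s : ℝ) (h : Set.Ioi (0 : ℝ)) (U : Opens (Eu d)) :
    HasDerivBounds s ⊤ h U := by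
  refine ⟨fun α => (weight s h.1 α)⁻¹, fun φ hφ α x => ?_⟩
  rw [inv_mul_eq_div, le_div_iff₀' (weight_pos s h.2 α)]
  exact LpSpace.weight_mul_norm_pderiv_le (contDiff_zeroExt_of_mem_testSubmodule hφ) α x

theorem enorm_pderiv_zeroExt_le_derivENorm {φ : U → ℂ} (hφ : φ ∈ testSubmodule s U)
    (α : Fin d → ℕ) (x : Eu d) :
    ‖pderiv α (zeroExt U φ) x‖ₑ ≤
      derivENorm p U φ (α + 1) * volume (U : Set (Eu d)) ^ (1 - 1 / p.toReal) := by
  have hsmooth := contDiff_zeroExt_of_mem_testSubmodule hφ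
  obtain ⟨hcompact, hsupp⟩ := hasCompactSupport_tsupport_subset_of_mem_testSubmodule hφ
  refine (enorm_pderiv_le_lintegral hsmooth hcompact α x).trans ?_
  rw [← setLIntegral_eq_of_support_subset (s := (U : Set (Eu d))), ← eLpNorm_one_eq_lintegral_enorm]
  · simpa [derivENorm] using
      eLpNorm_le_eLpNorm_mul_rpow_measure_univ (μ := volume.restrict (U : Set (Eu d))) hp.out
        (contDiff_pderiv hsmooth (α + 1)).continuous.aestronglyMeasurable
  · intro y hy
    by_contra hyU
    exact hy (by simp [pderiv_eq_zero_of_notMem_tsupport fun h => hyU (hsupp h)])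

theorem hasDerivBounds_of_volume_ne_top (s : ℝ) (p : ENNReal) [hp : Fact (1 ≤ p)]
    (h : Set.Ioi (0 : ℝ)) (hU : volume (U : Set (Eu d)) ≠ ⊤) : HasDerivBounds s p h U := by
  have hV : volume (U : Set (Eu d)) ^ (1 - 1 / p.toReal) ≠ ⊤ := by
    refine ENNReal.rpow_ne_top_of_nonneg ?_ hU
    rw [sub_nonneg, one_div, ← ENNReal.toReal_inv, ← ENNReal.toReal_one]
    exact ENNReal.toReal_mono ENNReal.one_ne_top (ENNReal.inv_le_one.2 hp.out)
  refine ⟨fun α => (volume (U : Set (Eu d)) ^ (1 - 1 / p.toReal)).toReal / weight s h.1 (α + 1),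
    fun φ hφ α x => ?_⟩
  have hw := weight_pos s h.2 (α + 1)
  have hb := (enorm_pderiv_zeroExt_le_derivENorm (p := p) hφ α x).trans
    (mul_le_mul_left (φ.derivENorm_le (α + 1)) _)
  have hb' := ENNReal.toReal_mono (by finiteness) hb
  rw [toReal_enorm, ENNReal.toReal_mul, ENNReal.toReal_ofReal (by positivity)] at hb'
  exact hb'.trans_eq (by ring)

theorem contDiff_zeroExt (hbd : HasDerivBounds s p h U) {φ : LpSpace s p h U}
    (hφ : φ ∈ LpClosure s p h U) : ContDiff ℝ ∞ (zeroExt U φ.fn) := by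
  obtain ⟨C, hC⟩ := hbd
  obtain ⟨t, ht, htφ, htt⟩ := exists_seq_of_mem_closure hφ
  have hts : ∀ n, ContDiff ℝ ∞ (zeroExt U (t n).fn) := fun n =>
    contDiff_zeroExt_of_mem_testSubmodule (ht n)
  have hsub : ∀ α n x, ‖pderiv α (zeroExt U (t (n + 1)).fn) x - pderiv α (zeroExt U (t n).fn) x‖ ≤
      C α * ‖t (n + 1) - t n‖ := fun α n x => by
    rw [← pderiv_sub α (hts (n + 1)).contDiffAt (hts n).contDiffAt, ← zeroExt_sub]
    exact hC (t (n + 1) - t n) (Submodule.sub_mem _ (ht (n + 1)) (ht n)) α x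
  have hsum : Summable fun n => ‖t (n + 1) - t n‖ :=
    (summable_geometric_two.mul_left 2).of_nonneg_of_le (fun _ => norm_nonneg _) htt
  obtain ⟨g, hg, hlim⟩ :=
    exists_contDiff_zeroExt_tendsto_pderiv hts (fun α => hsum.mul_left (C α)) hsub
  have hEq : Set.EqOn (zeroExt U g) (zeroExt U φ.fn) U :=
    eqOn_of_tendsto_of_tendsto_eLpNorm U.isOpen (one_pos.trans_le hp.out).ne'
      (fun n => (hts n).continuous.aestronglyMeasurable)
      (ContinuousOn.aestronglyMeasurable (ContDiffOn.continuousOn φ.2.1) U.isOpen.measurableSet)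
      hg.continuous.continuousOn (ContDiffOn.continuousOn φ.2.1)
      (fun x => by simpa only [pderiv_zero] using hlim 0 x)
      (LpSpace.tendsto_eLpNorm_zeroExt_sub htφ)
  have hφg : g = φ.fn := funext fun x => by
    simpa only [zeroExt_of_mem _ x.2] using hEq x.2
  exact hφg ▸ hg

end ExtensionByZero

section Completeness

variable {d : ℕ} {s : ℝ} {h : Set.Ioi (0 : ℝ)} {U : Opens (Eu d)}

theorem lpENorm_top_le {C : ℝ} {φ : U → ℂ}
    (H : ∀ α, ∀ x ∈ U, weight s h.1 α * ‖pderiv α (zeroExt U φ) x‖ ≤ C) :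
    lpENorm s ⊤ h.1 U φ ≤ ENNReal.ofReal C := by
  rw [lpENorm, if_pos rfl]
  refine iSup_le fun α => ?_
  have hw := weight_pos s h.2 α
  rw [mul_comm, ← ENNReal.le_div_iff_mul_le (Or.inl (ENNReal.ofReal_pos.2 hw).ne')
    (Or.inl ENNReal.ofReal_ne_top), ← ENNReal.ofReal_div_of_pos hw, derivENorm,
    eLpNorm_exponent_top]
  refine essSup_le_of_ae_le _ ?_
  filter_upwards [ae_restrict_mem U.isOpen.measurableSet] with x hx
  rw [← ofReal_norm]
  exact ENNReal.ofReal_le_ofReal ((le_div_iff₀' hw).2 (H α x hx))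

theorem LpSpace.norm_le {φ : LpSpace s ⊤ h U} {C : ℝ} (hC : 0 ≤ C)
    (H : ∀ α, ∀ x ∈ U, weight s h.1 α * ‖pderiv α (zeroExt U φ.fn) x‖ ≤ C) : ‖φ‖ ≤ C :=
  ENNReal.toReal_le_of_le_ofReal hC (lpENorm_top_le H)

theorem LpSpace.weight_mul_norm_pderiv_sub_le {φ ψ : LpSpace s ⊤ h U}
    (hφ : ContDiff ℝ ∞ (zeroExt U φ.fn)) (hψ : ContDiff ℝ ∞ (zeroExt U ψ.fn))
    (α : Fin d → ℕ) (x : Eu d) :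
    weight s h.1 α * ‖pderiv α (zeroExt U φ.fn) x - pderiv α (zeroExt U ψ.fn) x‖ ≤ ‖φ - ψ‖ := by
  have hsub : zeroExt U (φ - ψ).fn = zeroExt U φ.fn - zeroExt U ψ.fn := zeroExt_sub φ.fn ψ.fn
  rw [← pderiv_sub α hφ.contDiffAt hψ.contDiffAt, ← hsub]
  exact LpSpace.weight_mul_norm_pderiv_le (by rw [hsub]; exact hφ.sub hψ) α x

theorem LpSpace.exists_tendsto_of_contDiff_zeroExt {u : ℕ → LpSpace s ⊤ h U}
    (hu : ∀ n, ContDiff ℝ ∞ (zeroExt U (u n).fn))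
    (hcauchy : ∀ N n m, N ≤ n → N ≤ m → dist (u n) (u m) < (1 / 2) ^ N) :
    ∃ φ, Filter.Tendsto u Filter.atTop (𝓝 φ) := by
  have hsub : ∀ α N n m, N ≤ n → N ≤ m → ∀ x, weight s h.1 α *
      ‖pderiv α (zeroExt U (u n).fn) x - pderiv α (zeroExt U (u m).fn) x‖ ≤ (1 / 2) ^ N :=
    fun α N n m hn hm x => (LpSpace.weight_mul_norm_pderiv_sub_le (hu n) (hu m) α x).trans
      (by rw [← dist_eq_norm]; exact (hcauchy N n m hn hm).le)
  obtain ⟨f, hf, hlim⟩ := exists_contDiff_zeroExt_tendsto_pderiv hu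
    (M := fun α n => (1 / 2) ^ n / weight s h.1 α) (fun α => summable_geometric_two.div_const _)
    (fun α n x => (le_div_iff₀' (weight_pos s h.2 α)).2 (hsub α n _ _ n.le_succ le_rfl x))
  have hdiff : ∀ n α x, weight s h.1 α *
      ‖pderiv α (zeroExt U (f - (u n).fn)) x‖ ≤ (1 / 2) ^ n := fun n α x => by
    rw [zeroExt_sub, pderiv_sub α hf.contDiffAt (hu n).contDiffAt]
    exact le_of_tendsto ((((hlim α x).sub_const _).norm).const_mul _)
      (Filter.eventually_atTop.2 ⟨n, fun m hm => hsub α n m n hm le_rfl x⟩)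
  have hmem : f - (u 0).fn ∈ lpSubmodule s ⊤ h.1 U := by
    refine ⟨?_, (lpENorm_top_le fun α x _ => hdiff 0 α x).trans_lt ENNReal.ofReal_lt_top⟩
    rw [IsSmooth, zeroExt_sub]
    exact (hf.sub (hu 0)).contDiffOn
  let φ : LpSpace s ⊤ h U := ⟨f, sub_add_cancel f (u 0).fn ▸ add_mem hmem (u 0).2⟩
  refine ⟨φ, tendsto_iff_norm_sub_tendsto_zero.2 (squeeze_zero (fun _ => norm_nonneg _)
    (fun n => ?_) (tendsto_pow_atTop_nhds_zero_of_lt_one (r := (1 / 2 : ℝ)) (by norm_num)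
      (by norm_num)))⟩
  rw [norm_sub_rev]
  exact LpSpace.norm_le (by positivity) fun α x _ => hdiff n α x

theorem contDiff_zeroExt_top (φ : LpClosure s ⊤ h U) : ContDiff ℝ ∞ (zeroExt U φ.1.fn) :=
  contDiff_zeroExt (hasDerivBounds_top s h U) φ.2

instance : CompleteSpace (LpClosure s ⊤ h U) := by
  refine Metric.complete_of_convergent_controlled_sequences (fun n => (1 / 2) ^ n)
    (fun n => by positivity) fun u hu => ?_
  obtain ⟨φ, hφ⟩ := LpSpace.exists_tendsto_of_contDiff_zeroExt (u := fun n => (u n).1)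
    (fun n => contDiff_zeroExt_top (u n)) hu
  have hmem : φ ∈ LpClosure s ⊤ h U :=
    (Submodule.isClosed_topologicalClosure _).mem_of_tendsto hφ
      (Filter.Eventually.of_forall fun n => (u n).2)
  exact ⟨⟨φ, hmem⟩, tendsto_subtype_rng.2 hφ⟩

theorem lpENorm_top_eq_supENorm (s h : ℝ) {φ : U → ℂ} (hφ : ContDiff ℝ ∞ (zeroExt U φ)) :
    lpENorm s ⊤ h U φ = supENorm s h (closure (U : Set (Eu d))) (zeroExt U φ) := by
  simp only [lpENorm, if_true, supENorm, derivENorm, ENNReal.mul_iSup,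
    eLpNorm_top_restrict_eq_iSup_closure U.isOpen (contDiff_pderiv hφ _).continuous]

theorem zeroExt_mem_compSubmodule (φ : LpClosure s ⊤ h U) :
    zeroExt U φ.1.fn ∈ compSubmodule s h.1 (closure (U : Set (Eu d))) :=
  ⟨contDiff_zeroExt_top φ, tsupport_zeroExt_subset _, by
    rw [← lpENorm_top_eq_supENorm s h.1 (contDiff_zeroExt_top φ)]; exact φ.1.2.2⟩

variable (s h U) in
/-- The extension by zero `D^{(s)}_{L^∞,h}(U) → D^{s,h}_{closure U}`, as a linear isometry. -/
def extComp : LpClosure s ⊤ h U →ₗᵢ[ℂ] Comp s h (closure (U : Set (Eu d))) where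
  toFun φ := (⟨zeroExt U φ.1.fn, zeroExt_mem_compSubmodule φ⟩ : compSubmodule s h.1 _)
  map_add' φ ψ := Subtype.ext (zeroExt_add U φ.1.fn ψ.1.fn)
  map_smul' c φ := Subtype.ext (zeroExt_smul U c φ.1.fn)
  norm_map' φ := congrArg ENNReal.toReal
    (lpENorm_top_eq_supENorm s h.1 (contDiff_zeroExt_top φ)).symm

theorem isClosed_range_extComp : IsClosed (Set.range (extComp s h U)) :=
  (extComp s h U).isometry.isClosedEmbedding.isClosed_range

end Completeness

section ProjectiveLimit

theorem mem_closure_iInf_of_directed {X ι : Type*} [Nonempty ι] {t : ι → TopologicalSpace X}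
    (hd : Directed (· ≥ ·) t) {S : Set X} {x : X} :
    x ∈ @closure X (⨅ i, t i) S ↔ ∀ i, x ∈ @closure X (t i) S := by
  have hnhds : Directed (· ≥ ·) fun i => @nhds X (t i) x :=
    fun i j => (hd i j).imp fun _ hk => ⟨nhds_mono hk.1, nhds_mono hk.2⟩
  simp only [@mem_closure_iff_nhds X (⨅ i, t i), @mem_closure_iff_nhds X (t _), nhds_iInf,
    Filter.mem_iInf_of_directed hnhds]
  exact ⟨fun H i O hO => H O ⟨i, hO⟩, fun H O ⟨i, hO⟩ => H i O hO⟩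

variable {d : ℕ} {s : ℝ} {p : ENNReal} {U : Opens (Eu d)}

theorem lpENorm_mono (s : ℝ) (p : ENNReal) {h h₁ : ℝ} (hh : 0 ≤ h) (hle : h ≤ h₁) (φ : U → ℂ) :
    lpENorm s p h U φ ≤ lpENorm s p h₁ U φ := by
  have hweight : ∀ α : Fin d → ℕ, weight s h α ≤ weight s h₁ α := fun α => by
    unfold weight
    gcongr
  unfold lpENorm
  split_ifs
  · gcongr with α
    exact hweight α
  · gcongr with α
    exact hweight α

variable [Fact (1 ≤ p)] {h h₁ : Set.Ioi (0 : ℝ)}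

theorem lpSubmodule_mono (hle : h ≤ h₁) : lpSubmodule s p h₁.1 U ≤ lpSubmodule s p h.1 U :=
  fun φ hφ => ⟨hφ.1, (lpENorm_mono s p h.2.le hle φ).trans_lt hφ.2⟩

/-- The inclusion `D^s_{L^p,h₁}(U) → D^s_{L^p,h}(U)` for `h ≤ h₁`. -/
def LpSpace.link (s : ℝ) (p : ENNReal) [Fact (1 ≤ p)] (U : Opens (Eu d)) (hle : h ≤ h₁) :
    LpSpace s p h₁ U →L[ℂ] LpSpace s p h U :=
  LinearMap.mkContinuous (Submodule.inclusion (lpSubmodule_mono hle)) 1 fun φ => by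
    rw [one_mul]
    exact ENNReal.toReal_mono φ.2.2.ne (lpENorm_mono s p h.2.le hle φ.fn)

theorem LpSpace.link_mem_LpClosure (hle : h ≤ h₁) {φ : LpSpace s p h₁ U}
    (hφ : φ ∈ LpClosure s p h₁ U) : LpSpace.link s p U hle φ ∈ LpClosure s p h U :=
  map_mem_closure (LpSpace.link s p U hle).continuous hφ fun _ hψ => hψ

/-- The linking inclusion `D^{(s)}_{L^p,h₁}(U) → D^{(s)}_{L^p,h}(U)` for `h ≤ h₁`. -/
def LpClosure.link (s : ℝ) (p : ENNReal) [Fact (1 ≤ p)] (U : Opens (Eu d)) (hle : h ≤ h₁) :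
    LpClosure s p h₁ U →L[ℂ] LpClosure s p h U :=
  ((LpSpace.link s p U hle).comp (LpClosure s p h₁ U).subtypeL).codRestrict _ fun φ =>
    LpSpace.link_mem_LpClosure hle φ.2

theorem LpClosure.fn_injective :
    Function.Injective fun φ : LpClosure s p h U => φ.1.fn :=
  Subtype.val_injective.comp Subtype.val_injective

theorem BDot.fn_injective : Function.Injective fun φ : BDot s U => φ.1.fn :=
  Subtype.val_injective.comp Subtype.val_injective

/-- The inclusion `B^{(s)}_{L^p}(U) → D^s_{L^p,h}(U)`, as a continuous linear map. -/
def Beurling.inclL (s : ℝ) (p : ENNReal) [Fact (1 ≤ p)] (U : Opens (Eu d))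
    (h : Set.Ioi (0 : ℝ)) : Beurling s p U →L[ℂ] LpSpace s p h U :=
  ⟨Beurling.incl s p U h, continuous_iInf_dom continuous_induced_dom⟩

theorem Beurling.inclL_mem_LpClosure (h : Set.Ioi (0 : ℝ)) {φ : Beurling s ⊤ U}
    (hφ : φ ∈ BDot s U) : Beurling.inclL s ⊤ U h φ ∈ LpClosure s ⊤ h U :=
  map_mem_closure (Beurling.inclL s ⊤ U h).continuous hφ fun _ hψ => hψ

/-- The inclusion `Ḃ^{(s)}(U) → D^{(s)}_{L^∞,h}(U)`. -/
def BDot.proj (s : ℝ) (U : Opens (Eu d)) (h : Set.Ioi (0 : ℝ)) :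
    BDot s U →L[ℂ] LpClosure s ⊤ h U :=
  ((Beurling.inclL s ⊤ U h).comp (BDot s U).subtypeL).codRestrict _ fun φ =>
    Beurling.inclL_mem_LpClosure h φ.2

theorem BDot.topology_eq_iInf : (inferInstance : TopologicalSpace (BDot s U)) =
    ⨅ h, TopologicalSpace.induced (BDot.proj s U h) inferInstance := by
  change TopologicalSpace.induced Subtype.val (⨅ h, _) = _
  rw [induced_iInf]
  refine iInf_congr fun h => ?_
  change _ = TopologicalSpace.induced _ (TopologicalSpace.induced Subtype.val _)
  rw [induced_compose, induced_compose]
  rfl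

theorem testSubmodule_le_beurlingSubmodule : testSubmodule s U ≤ beurlingSubmodule s ⊤ U := by
  intro φ hφ
  have hsmooth := contDiff_zeroExt_of_mem_testSubmodule hφ
  obtain ⟨K, -, hKU, hK⟩ := hφ
  refine (Submodule.mem_iInf _).2 fun h => ⟨hsmooth.contDiffOn, ?_⟩
  rw [lpENorm_top_eq_supENorm s h.1 hsmooth]
  exact ((Submodule.mem_iInf _).1 (zeroExt_mem_mono (hKU.trans subset_closure) hK) h).2.2

theorem mem_BDot_of_forall_mem_LpClosure {φ : Beurling s ⊤ U}
    (H : ∀ h, Beurling.incl s ⊤ U h φ ∈ LpClosure s ⊤ h U) : φ ∈ BDot s U := by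
  have hdir : Directed (· ≥ ·) fun h : Set.Ioi (0 : ℝ) =>
      TopologicalSpace.induced (Beurling.incl s ⊤ U h) inferInstance := by
    refine Antitone.directed_ge fun h h₁ hle => ?_
    change TopologicalSpace.induced _ _ ≤
      TopologicalSpace.induced (LpSpace.link s ⊤ U hle ∘ Beurling.incl s ⊤ U h₁) _
    rw [← induced_compose]
    exact induced_mono (LpSpace.link s ⊤ U hle).continuous.le_induced
  have : Nonempty (Set.Ioi (0 : ℝ)) := ⟨⟨1, Set.mem_Ioi.2 one_pos⟩⟩
  refine (mem_closure_iInf_of_directed hdir).2 fun h => closure_induced.2 ?_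
  refine closure_mono (fun t ht => ?_) (H h)
  exact ⟨⟨t.fn, testSubmodule_le_beurlingSubmodule ht⟩, ht, rfl⟩

theorem exists_BDot_fn_eq {f : U → ℂ}
    (H : ∀ h : Set.Ioi (0 : ℝ), ∃ φ : LpClosure s ⊤ h U, φ.1.fn = f) :
    ∃ φ : BDot s U, φ.1.fn = f := by
  choose φ hφ using H
  have hf : f ∈ beurlingSubmodule s ⊤ U := (Submodule.mem_iInf _).2 fun h => hφ h ▸ (φ h).1.2
  refine ⟨⟨⟨f, hf⟩, mem_BDot_of_forall_mem_LpClosure fun h => ?_⟩, rfl⟩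
  have hincl : Beurling.incl s ⊤ U h ⟨f, hf⟩ = (φ h).1 := Subtype.ext (hφ h).symm
  exact hincl ▸ (φ h).2

theorem isTVSProjectiveLimit_BDot (s : ℝ) (U : Opens (Eu d)) :
    IsTVSProjectiveLimit (fun (h h₁ : Set.Ioi (0 : ℝ)) (hle : h ≤ h₁) => LpClosure.link s ⊤ U hle)
      (BDot.proj s U) where
  link_refl _ _ := rfl
  link_trans _ _ _ _ _ _ := rfl
  isEmbedding := by
    refine ⟨⟨BDot.topology_eq_iInf.trans ?_⟩, fun φ ψ hφψ => BDot.fn_injective ?_⟩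
    · rw [Pi.topologicalSpace, induced_iInf]
      exact iInf_congr fun h => by rw [induced_compose]; rfl
    · exact congrArg (fun χ => χ.1.fn) (congrFun hφψ ⟨1, Set.mem_Ioi.2 one_pos⟩)
  range_eq := by
    refine Set.Subset.antisymm (Set.range_subset_iff.2 fun _ _ _ _ => rfl) fun y hy => ?_
    have hfn : ∀ h h₁, h ≤ h₁ → (y h₁).1.fn = (y h).1.fn := fun h h₁ hle =>
      congrArg (fun χ => χ.1.fn) (hy h h₁ hle)
    have hconst : ∀ h h₁, (y h).1.fn = (y h₁).1.fn := fun h h₁ =>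
      (hfn h _ le_sup_left).symm.trans (hfn h₁ _ le_sup_right)
    obtain ⟨φ, hφ⟩ := exists_BDot_fn_eq fun h => ⟨y h, hconst h ⟨1, Set.mem_Ioi.2 one_pos⟩⟩
    exact ⟨φ, funext fun h => LpClosure.fn_injective (hφ.trans (hconst _ h))⟩

/-- The extension by zero `Ḃ^{(s)}(U) → D^{(s)}_{closure U}`, as a linear map. -/
def BDot.extₗ (s : ℝ) (U : Opens (Eu d)) :
    BDot s U →ₗ[ℂ] BeurlingComp s (closure (U : Set (Eu d))) where
  toFun φ := (⟨zeroExt U φ.1.fn, (Submodule.mem_iInf _).2 fun h =>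
    zeroExt_mem_compSubmodule (BDot.proj s U h φ)⟩ : beurlingCompSubmodule s _)
  map_add' φ ψ := Subtype.ext (zeroExt_add U φ.1.fn ψ.1.fn)
  map_smul' c φ := Subtype.ext (zeroExt_smul U c φ.1.fn)

theorem BDot.isInducing_extₗ : IsInducing (BDot.extₗ s U) := by
  refine ⟨BDot.topology_eq_iInf.trans ?_⟩
  change _ = TopologicalSpace.induced _ (⨅ h, _)
  rw [induced_iInf]
  refine iInf_congr fun h => ?_
  rw [induced_compose]
  change _ = TopologicalSpace.induced (extComp s h U ∘ BDot.proj s U h) _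
  rw [← induced_compose, ← (extComp s h U).isometry.isUniformInducing.isInducing.eq_induced]
  rfl

theorem BDot.isClosedEmbedding_extₗ : IsClosedEmbedding (BDot.extₗ s U) := by
  refine ⟨⟨BDot.isInducing_extₗ, fun φ ψ hφψ => BDot.fn_injective
    (zeroExt_injective (congrArg BeurlingComp.fn hφψ))⟩,
    isClosed_of_closure_subset fun f hf => ?_⟩
  have hrange : ∀ h, ∃ φ : LpClosure s ⊤ h U, zeroExt U φ.1.fn = f.fn := fun h => by
    have hcont : Continuous (BeurlingComp.incl s (closure (U : Set (Eu d))) h) :=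
      continuous_iInf_dom continuous_induced_dom
    have hmem : BeurlingComp.incl s _ h f ∈ closure (Set.range (extComp s h U)) :=
      map_mem_closure hcont hf (Set.forall_mem_range.2 fun φ => ⟨BDot.proj s U h φ, rfl⟩)
    rw [isClosed_range_extComp.closure_eq] at hmem
    obtain ⟨φ, hφ⟩ := hmem
    exact ⟨φ, congrArg Comp.fn hφ⟩
  choose φ hφ using hrange
  let h₀ : Set.Ioi (0 : ℝ) := ⟨1, Set.mem_Ioi.2 one_pos⟩
  obtain ⟨ψ, hψ⟩ := exists_BDot_fn_eq fun h =>
    ⟨φ h, zeroExt_injective ((hφ h).trans (hφ h₀).symm)⟩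
  exact ⟨ψ, Subtype.ext ((congrArg (zeroExt U) hψ).trans (hφ h₀))⟩

end ProjectiveLimit

section Grids

variable {d : ℕ}

theorem exists_fin_near {R : ℝ} {N : ℕ} (hN : 0 < N) {t : ℝ} (ht : |t| < R) :
    ∃ m : Fin N, |t - (-R + 2 * R * m / N)| ≤ 2 * R / N := by
  obtain ⟨hRt, htR⟩ := abs_lt.1 ht
  have hR : 0 < R := (abs_nonneg t).trans_lt ht
  have hN' : (0 : ℝ) < N := Nat.cast_pos.2 hN
  let z := (t + R) * N / (2 * R)
  have hz₀ : 0 ≤ z := div_nonneg (mul_nonneg (by linarith) hN'.le) (by linarith)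
  have hzN : z < N := by
    rw [div_lt_iff₀ (by positivity)]
    nlinarith
  refine ⟨⟨⌊z⌋₊, (Nat.floor_lt hz₀).2 hzN⟩, ?_⟩
  have hdiff : t - (-R + 2 * R * ⌊z⌋₊ / N) = 2 * R / N * (z - ⌊z⌋₊) := by
    simp only [z]
    field_simp
    ring
  rw [hdiff, abs_of_nonneg (mul_nonneg (by positivity) (sub_nonneg.2 (Nat.floor_le hz₀)))]
  exact mul_le_of_le_one_right (by positivity) (by linarith [Nat.lt_floor_add_one z])

theorem norm_le_of_forall_abs_le {v : Eu d} {c : ℝ} (H : ∀ j, |v j| ≤ c) : ‖v‖ ≤ d * c := by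
  rw [← (stdBasis d).sum_repr v]
  calc ‖∑ j, (stdBasis d).repr v j • stdBasis d j‖
      ≤ ∑ j, ‖(stdBasis d).repr v j • stdBasis d j‖ := norm_sum_le _ _
    _ ≤ ∑ _j : Fin d, c := Finset.sum_le_sum fun j _ => by simpa [norm_smul] using H j
    _ = d * c := by simp

theorem exists_grid_of_isBounded {S : Set (Eu d)} (hS : Bornology.IsBounded S) {ε : ℝ}
    (hε : 0 < ε) : ∃ N₀ : ℕ, ∀ N > 0, ∃ g : (Fin d → Fin (N₀ * N)) → Eu d,
      ∀ x ∈ S, ∃ k, ‖x - g k‖ ≤ ε / N := by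
  obtain ⟨R, hR, hSR⟩ := hS.exists_pos_norm_lt
  obtain ⟨N₀, hN₀⟩ := exists_nat_gt (d * (2 * R) / ε)
  have hN₀_pos : 0 < N₀ := by
    exact_mod_cast (show 0 ≤ d * (2 * R) / ε by positivity).trans_lt hN₀
  refine ⟨N₀, fun N hN => ⟨fun k => WithLp.toLp 2 fun j => -R + 2 * R * k j / (N₀ * N : ℕ),
    fun x hx => ?_⟩⟩
  choose k hk using fun j => exists_fin_near (Nat.mul_pos hN₀_pos hN)
    ((PiLp.norm_apply_le x j).trans_lt (hSR x hx))
  refine ⟨k, (norm_le_of_forall_abs_le hk).trans ?_⟩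
  have hN' : (0 : ℝ) < N := Nat.cast_pos.2 hN
  rw [Nat.cast_mul, mul_div_assoc', div_le_div_iff₀ (by positivity) hN']
  exact (mul_le_mul_of_nonneg_right ((div_lt_iff₀' hε).1 hN₀).le hN'.le).trans_eq (mul_assoc _ _ _)

theorem weight_add_single (s h : ℝ) (α : Fin d → ℕ) (j : Fin d) :
    weight s h (α + Pi.single j 1) = weight s h α * (h / ((α j : ℝ) + 1) ^ s) := by
  have hfactorial : ∀ i, ((α + Pi.single j 1 : Fin d → ℕ) i).factorial =
      (α i).factorial * if i = j then α j + 1 else 1 := fun i => by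
    rcases eq_or_ne i j with rfl | hij
    · simp [Nat.factorial_succ, mul_comm]
    · simp [hij]
  have hprod : ∏ i, ((α + Pi.single j 1 : Fin d → ℕ) i).factorial =
      (∏ i, (α i).factorial) * (α j + 1) := by
    simp only [hfactorial, Finset.prod_mul_distrib, Finset.prod_ite_eq', Finset.mem_univ, if_true]
  have hsum : ∑ i, (α + Pi.single j 1 : Fin d → ℕ) i = (∑ i, α i) + 1 := by
    simp [Finset.sum_add_distrib]
  unfold weight
  rw [hprod, hsum, pow_succ, Nat.cast_mul, Real.mul_rpow (by positivity) (by positivity),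
    mul_div_mul_comm]
  push_cast
  rfl

theorem succ_rpow_le {s A : ℝ} (hA : 2 ^ |s| ≤ A) (α : Fin d → ℕ) (j : Fin d) :
    ((α j : ℝ) + 1) ^ s ≤ A ^ ∑ i, α i := by
  have hle : α j + 1 ≤ 2 ^ ∑ i, α i :=
    Nat.lt_two_pow_self.trans_le (Nat.pow_le_pow_right two_pos
      (Finset.single_le_sum (fun _ _ => Nat.zero_le _) (Finset.mem_univ j)))
  calc ((α j : ℝ) + 1) ^ s ≤ ((α j : ℝ) + 1) ^ |s| :=
        Real.rpow_le_rpow_of_exponent_le (by simp) (le_abs_self s)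
    _ ≤ ((2 : ℝ) ^ ∑ i, α i) ^ |s| :=
        Real.rpow_le_rpow (by positivity) (by exact_mod_cast hle) (abs_nonneg s)
    _ = ((2 : ℝ) ^ |s|) ^ ∑ i, α i := Real.rpow_pow_comm two_pos.le _ _ |>.symm
    _ ≤ A ^ ∑ i, α i := by gcongr

theorem weight_mul_norm_pderiv_sub_le {s h : ℝ} (hh : 0 < h) {f : Eu d → ℂ}
    (hf : ContDiff ℝ ∞ f) {D : ℝ} (hD : ∀ β x, weight s h β * ‖pderiv β f x‖ ≤ D) {A : ℝ}
    (hA : 2 ^ |s| ≤ A) (α : Fin d → ℕ) (x y : Eu d) :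
    weight s h α * ‖pderiv α f x - pderiv α f y‖ ≤ d * (A ^ (∑ i, α i) / h * D) * ‖x - y‖ := by
  have hw := weight_pos s hh α
  have hderiv : ∀ j z, ‖pderiv (α + Pi.single j 1) f z‖ ≤
      A ^ (∑ i, α i) / h * D / weight s h α := fun j z => by
    have hD₀ : 0 ≤ D := (mul_nonneg hw.le (norm_nonneg _)).trans (hD α z)
    have hpos : (0 : ℝ) < ((α j : ℝ) + 1) ^ s := by positivity
    have hj := hD (α + Pi.single j 1) z
    rw [weight_add_single, mul_assoc, div_mul_eq_mul_div, mul_div_assoc', div_le_iff₀ hpos] at hj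
    rw [le_div_iff₀ hw, div_mul_eq_mul_div, le_div_iff₀ hh]
    calc ‖pderiv (α + Pi.single j 1) f z‖ * weight s h α * h
        = weight s h α * (h * ‖pderiv (α + Pi.single j 1) f z‖) := by ring
      _ ≤ D * ((α j : ℝ) + 1) ^ s := hj
      _ ≤ D * A ^ ∑ i, α i := mul_le_mul_of_nonneg_left (succ_rpow_le hA α j) hD₀
      _ = A ^ (∑ i, α i) * D := mul_comm _ _
  calc weight s h α * ‖pderiv α f x - pderiv α f y‖
      ≤ weight s h α * (d * (A ^ (∑ i, α i) / h * D / weight s h α) * ‖x - y‖) := by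
        gcongr
        exact norm_pderiv_sub_le hf α hderiv x y
    _ = d * (A ^ (∑ i, α i) / h * D) * ‖x - y‖ := by
        field_simp

/-- The index set for sampling the derivatives of a function: for every multi-index `α`, the nodes
of a grid with `N * A ^ |α|` nodes in each coordinate direction. -/
abbrev GridIndex (d N A : ℕ) : Type :=
  Σ α : Fin d → ℕ, Fin d → Fin (N * A ^ ∑ j, α j)

variable {N A : ℕ}

theorem GridIndex.tendsto_pow {θ : ℝ} (hθ₀ : 0 ≤ θ) (hθ : θ < 1) :
    Filter.Tendsto (fun i : GridIndex d N A => θ ^ ∑ j, i.1 j) Filter.cofinite (𝓝 0) := by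
  have hfst : Filter.Tendsto (Sigma.fst : GridIndex d N A → _) Filter.cofinite Filter.cofinite :=
    .cofinite_of_finite_preimage_singleton fun α => by
      rw [← Set.range_sigmaMk]
      exact Set.finite_range _
  have hsum : Filter.Tendsto (fun α : Fin d → ℕ => ∑ j, α j) Filter.cofinite Filter.cofinite :=
    .cofinite_of_finite_preimage_singleton fun n =>
      (Finset.piAntidiag Finset.univ n).finite_toSet.subset fun α hα => by
        simpa using hα
  rw [Nat.cofinite_eq_atTop] at hsum
  exact (tendsto_pow_atTop_nhds_zero_of_lt_one hθ₀ hθ).comp (hsum.comp hfst)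

theorem summable_pow_sum {θ : ℝ} (hθ₀ : 0 ≤ θ) (hθ : θ < 1) (d : ℕ) :
    Summable fun α : Fin d → ℕ => θ ^ ∑ j, α j := by
  induction d with
  | zero => exact (hasSum_fintype _).summable
  | succ d ih =>
    rw [← (Fin.consEquiv fun _ : Fin (d + 1) => ℕ).summable_iff]
    refine ((summable_geometric_of_lt_one hθ₀ hθ).mul_of_nonneg ih (fun _ => by positivity)
      fun _ => by positivity).congr fun p => ?_
    simp [Fin.consEquiv, Fin.sum_univ_succ, pow_add]

theorem GridIndex.summable_pow {θ : ℝ} (hθ₀ : 0 ≤ θ) (hθ : (A : ℝ) ^ d * θ < 1) :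
    Summable fun i : GridIndex d N A => θ ^ ∑ j, i.1 j := by
  rw [summable_sigma_of_nonneg fun _ => by positivity]
  refine ⟨fun α => (hasSum_fintype _).summable, ?_⟩
  refine ((summable_pow_sum (by positivity) hθ d).mul_left ((N : ℝ) ^ d)).congr fun α => ?_
  simp only [tsum_fintype, Finset.sum_const, Finset.card_univ, Fintype.card_pi, Fintype.card_fin,
    Finset.prod_const, nsmul_eq_mul, Nat.cast_pow, Nat.cast_mul]
  ring

end Grids

section Sampling

variable {d : ℕ} {s : ℝ} {h h₁ : Set.Ioi (0 : ℝ)} {U : Opens (Eu d)}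

/-- The weighted value `h^|α| / α!^s * ∂^α φ(x)`, as a linear functional of `φ`. -/
def LpClosure.sample (α : Fin d → ℕ) (x : Eu d) : LpClosure s ⊤ h U →ₗ[ℂ] ℂ where
  toFun φ := weight s h.1 α * pderiv α (zeroExt U φ.1.fn) x
  map_add' φ ψ := by
    have hadd : zeroExt U (φ + ψ).1.fn = zeroExt U φ.1.fn + zeroExt U ψ.1.fn :=
      zeroExt_add U φ.1.fn ψ.1.fn
    rw [hadd, pderiv_add α (contDiff_zeroExt_top φ).contDiffAt (contDiff_zeroExt_top ψ).contDiffAt,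
      mul_add]
  map_smul' c φ := by
    have hsmul : zeroExt U (c • φ).1.fn = c • zeroExt U φ.1.fn := zeroExt_smul U c φ.1.fn
    rw [hsmul, pderiv_smul α c (contDiff_zeroExt_top φ).contDiffAt, mul_left_comm, RingHom.id_apply,
      smul_eq_mul]

theorem LpClosure.norm_sample (α : Fin d → ℕ) (x : Eu d) (φ : LpClosure s ⊤ h U) :
    ‖LpClosure.sample α x φ‖ = weight s h.1 α * ‖pderiv α (zeroExt U φ.1.fn) x‖ := by
  change ‖(weight s h.1 α : ℂ) * _‖ = _
  rw [norm_mul, Complex.norm_real, Real.norm_of_nonneg (weight_pos s h.2 α).le]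

theorem LpClosure.norm_sample_link_le (hle : h ≤ h₁) (α : Fin d → ℕ) (x : Eu d)
    (φ : LpClosure s ⊤ h₁ U) :
    ‖LpClosure.sample α x (LpClosure.link s ⊤ U hle φ)‖ ≤ (h.1 / h₁.1) ^ (∑ j, α j) * ‖φ‖ := by
  have hh₁ : h₁.1 ≠ 0 := (Set.mem_Ioi.1 h₁.2).ne'
  have hweight : weight s h.1 α = (h.1 / h₁.1) ^ (∑ j, α j) * weight s h₁.1 α := by
    rw [weight, weight, div_pow]
    field_simp
  rw [LpClosure.norm_sample, hweight, mul_assoc]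
  refine mul_le_mul_of_nonneg_left ?_ (pow_nonneg (div_nonneg h.2.le h₁.2.le) _)
  exact LpSpace.weight_mul_norm_pderiv_le (contDiff_zeroExt_top φ) α x

/-- Between a point of `U` and a grid point nearby, a derivative of order `|α|` varies by at most
half of the norm as soon as the mesh width is a small multiple of `A ^ (-|α|)`. -/
theorem LpClosure.exists_isNormingFamily_sample (s : ℝ) (h : Set.Ioi (0 : ℝ))
    (hU : Bornology.IsBounded (U : Set (Eu d))) : ∃ (N A : ℕ) (g : GridIndex d N A → Eu d), 0 < A ∧
      IsNormingFamily 2 fun i => (LpClosure.sample i.1 (g i) : LpClosure s ⊤ h U →ₗ[ℂ] ℂ) := by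
  have hh : 0 < h.1 := h.2
  let A := ⌈(2 : ℝ) ^ |s|⌉₊
  have hA : 0 < A := Nat.ceil_pos.2 (by positivity)
  obtain ⟨N, hN⟩ := exists_grid_of_isBounded hU (ε := h.1 / (2 * (d + 1))) (by positivity)
  choose g hg using fun α : Fin d → ℕ => hN (A ^ ∑ j, α j) (by positivity)
  refine ⟨N, A, fun i => g i.1 i.2, hA, fun φ D hD₀ hD => ?_⟩
  suffices ‖φ‖ ≤ D + ‖φ‖ / 2 by linarith
  refine LpSpace.norm_le (by positivity) fun α x hx => ?_
  obtain ⟨k, hk⟩ := hg α x hx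
  have hnode := hD ⟨α, k⟩
  rw [LpClosure.norm_sample] at hnode
  have hvar : weight s h.1 α * ‖pderiv α (zeroExt U φ.1.fn) x -
      pderiv α (zeroExt U φ.1.fn) (g α k)‖ ≤ ‖φ‖ / 2 := by
    refine (weight_mul_norm_pderiv_sub_le hh (contDiff_zeroExt_top φ)
      (fun β y => LpSpace.weight_mul_norm_pderiv_le (contDiff_zeroExt_top φ) β y)
      (Nat.le_ceil _) α x (g α k)).trans ?_
    have hA' : (0 : ℝ) < A := Nat.cast_pos.2 hA
    rw [Nat.cast_pow] at hk
    calc d * (A ^ (∑ j, α j) / h.1 * ‖φ‖) * ‖x - g α k‖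
        ≤ d * (A ^ (∑ j, α j) / h.1 * ‖φ‖) * (h.1 / (2 * (d + 1)) / A ^ ∑ j, α j) := by gcongr
      _ = d / (d + 1) * (‖φ‖ / 2) := by field_simp
      _ ≤ ‖φ‖ / 2 := mul_le_of_le_one_left (by positivity) (div_le_one_of_le₀ (by simp)
          (by positivity))
  calc weight s h.1 α * ‖pderiv α (zeroExt U φ.1.fn) x‖
      ≤ weight s h.1 α * (‖pderiv α (zeroExt U φ.1.fn) (g α k)‖ +
          ‖pderiv α (zeroExt U φ.1.fn) x - pderiv α (zeroExt U φ.1.fn) (g α k)‖) := by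
        gcongr
        · exact (weight_pos s hh α).le
        · exact norm_le_norm_add_norm_sub' _ _
    _ ≤ D + ‖φ‖ / 2 := by
        rw [mul_add]
        exact add_le_add hnode hvar

theorem LpClosure.isCompactOperator_link (s : ℝ) (hU : Bornology.IsBounded (U : Set (Eu d)))
    (hlt : h < h₁) : IsCompactOperator (LpClosure.link s ⊤ U hlt.le) := by
  obtain ⟨N, A, g, -, hg⟩ := LpClosure.exists_isNormingFamily_sample s h hU
  have hθ₀ : 0 ≤ h.1 / h₁.1 := div_nonneg h.2.le h₁.2.le
  exact hg.isCompactOperator (T := (LpClosure.link s ⊤ U hlt.le).toLinearMap)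
    (fun i => pow_nonneg hθ₀ _) (fun i φ => LpClosure.norm_sample_link_le hlt.le i.1 (g i) φ)
    (GridIndex.tendsto_pow hθ₀ ((div_lt_one h₁.2).2 hlt))

theorem isNuclearSpace_BDot (s : ℝ) (hU : Bornology.IsBounded (U : Set (Eu d))) :
    IsNuclearSpace (BDot s U) := by
  refine (isTVSProjectiveLimit_BDot s U).isNuclearSpace fun h => ?_
  have hh : 0 < h.1 := h.2
  obtain ⟨N, A, g, hA, hg⟩ := LpClosure.exists_isNormingFamily_sample s h hU
  have hA' : (1 : ℝ) ≤ A := Nat.one_le_cast.2 hA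
  have hle : h.1 ≤ 2 * A ^ d * h.1 := le_mul_of_one_le_left hh.le
    (one_le_mul_of_one_le_of_one_le one_le_two (one_le_pow₀ hA'))
  let h₁ : Set.Ioi (0 : ℝ) := ⟨2 * A ^ d * h.1, hh.trans_le hle⟩
  have hθ₀ : 0 ≤ h.1 / h₁.1 := div_nonneg hh.le h₁.2.le
  have hθ : (A : ℝ) ^ d * (h.1 / h₁.1) < 1 := by
    have hhalf : (A : ℝ) ^ d * (h.1 / (2 * A ^ d * h.1)) = 1 / 2 := by field_simp
    exact hhalf.trans_lt one_half_lt_one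
  exact ⟨h₁, hle, GridIndex d N A, inferInstance, _, 2, _, hg, fun i => pow_nonneg hθ₀ _,
    GridIndex.summable_pow hθ₀ hθ, fun i φ => LpClosure.norm_sample_link_le hle i.1 (g i) φ⟩

theorem isFSSpace_BDot (s : ℝ) (hU : Bornology.IsBounded (U : Set (Eu d))) :
    IsFSSpace (BDot s U) := by
  let H : ℕ → Set.Ioi (0 : ℝ) := fun n => ⟨n + 1, Set.mem_Ioi.2 n.cast_add_one_pos⟩
  have hH : StrictMono H := fun m n hmn => Subtype.mk_lt_mk.2 (by gcongr)
  have hcof : ∀ h, ∃ n, h ≤ H n := fun h => by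
    obtain ⟨n, hn⟩ := exists_nat_ge h.1
    exact ⟨n, hn.trans (by simp [H])⟩
  exact ⟨fun n => LpClosure s ⊤ (H n) U, inferInstance, inferInstance, _, _, inferInstance,
    (isTVSProjectiveLimit_BDot s U).comp_cofinal hH.monotone hcof,
    fun m n hmn => LpClosure.isCompactOperator_link s hU (hH hmn)⟩

end Sampling

end Gevrey

end

open Gevrey in
theorem proposition60_general {d : ℕ} (s : ℝ) (U : Opens (Eu d))
    (hU : Bornology.IsBounded (U : Set (Eu d))) :
    (∀ (p : ENNReal) [Fact (1 ≤ p)] (h : Set.Ioi (0 : ℝ)) (φ : LpClosure s p h U),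
      ∃ ψ : Eu d → ℂ, ContDiff ℝ ∞ ψ ∧ tsupport ψ ⊆ closure (U : Set (Eu d)) ∧
        ∀ x : U, ψ x = φ.1.fn x) ∧
    (∀ h : Set.Ioi (0 : ℝ),
      ∃ ι : LpClosure s ⊤ h U →ₗᵢ[ℂ] Comp s h (closure (U : Set (Eu d))),
        (∀ φ, (ι φ).fn = zeroExt U φ.1.fn) ∧ IsClosed (Set.range ι)) ∧
    (∃ ι : BDot s U →L[ℂ] BeurlingComp s (closure (U : Set (Eu d))),
      (∀ φ, (ι φ).fn = zeroExt U φ.1.fn) ∧ IsClosedEmbedding ι) ∧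
    IsNuclearSpace (BDot s U) ∧ IsFSSpace (BDot s U) ∧
    (∃ (u : ∀ h h₁ : Set.Ioi (0 : ℝ), h ≤ h₁ → (LpClosure s ⊤ h₁ U →L[ℂ] LpClosure s ⊤ h U))
      (π : ∀ h : Set.Ioi (0 : ℝ), BDot s U →L[ℂ] LpClosure s ⊤ h U),
      (∀ h h₁ hle φ, (u h h₁ hle φ).1.fn = φ.1.fn) ∧
      (∀ h φ, (π h φ).1.fn = φ.1.fn) ∧
      IsTVSProjectiveLimit u π ∧
      ∀ h h₁ (hlt : h < h₁), IsCompactOperator (u h h₁ hlt.le)) := by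
  refine ⟨fun p _ h φ => ⟨zeroExt U φ.1.fn, ?_, tsupport_zeroExt_subset _,
      fun x => zeroExt_of_mem _ x.2⟩,
    fun h => ⟨extComp s h U, fun _ => rfl, isClosed_range_extComp⟩,
    ⟨⟨BDot.extₗ s U, BDot.isInducing_extₗ.continuous⟩, fun _ => rfl,
      BDot.isClosedEmbedding_extₗ⟩,
    isNuclearSpace_BDot s hU, isFSSpace_BDot s hU,
    ⟨fun _ _ hle => LpClosure.link s ⊤ U hle, BDot.proj s U, fun _ _ _ _ => rfl, fun _ _ => rfl,
      isTVSProjectiveLimit_BDot s U, fun _ _ hlt => LpClosure.isCompactOperator_link s hU hlt⟩⟩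
  exact contDiff_zeroExt (hasDerivBounds_of_volume_ne_top s p h hU.measure_lt_top.ne) φ.2

open Gevrey in
theorem proposition60 {d : ℕ} {s : ℝ} (hs : 1 < s) (U : Opens (Eu d))
    (hU : Bornology.IsBounded (U : Set (Eu d))) :
    -- i), first part: smooth extension with support in the closure of `U`
    (∀ (p : ENNReal) [Fact (1 ≤ p)] (h : Set.Ioi (0 : ℝ)) (φ : LpClosure s p h U),
      ∃ ψ : Eu d → ℂ, ContDiff ℝ ∞ ψ ∧ tsupport ψ ⊆ closure (U : Set (Eu d)) ∧
        ∀ x : U, ψ x = φ.1.fn x) ∧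
    -- i), second part: extension by zero is an isometry onto a closed subspace
    (∀ h : Set.Ioi (0 : ℝ),
      ∃ ι : LpClosure s ⊤ h U →ₗᵢ[ℂ] Comp s h (closure (U : Set (Eu d))),
        (∀ φ, (ι φ).fn = zeroExt U φ.1.fn) ∧ IsClosed (Set.range ι)) ∧
    -- ii): extension by zero identifies `Ḃ^{(s)}(U)` with a closed subspace
    (∃ ι : BDot s U →L[ℂ] BeurlingComp s (closure (U : Set (Eu d))),
      (∀ φ, (ι φ).fn = zeroExt U φ.1.fn) ∧ IsClosedEmbedding ι) ∧
    -- iii): nuclear (FS)-space, with compact linking inclusions in the projective limit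
    IsNuclearSpace (BDot s U) ∧ IsFSSpace (BDot s U) ∧
    (∃ (u : ∀ h h₁ : Set.Ioi (0 : ℝ), h ≤ h₁ → (LpClosure s ⊤ h₁ U →L[ℂ] LpClosure s ⊤ h U))
      (π : ∀ h : Set.Ioi (0 : ℝ), BDot s U →L[ℂ] LpClosure s ⊤ h U),
      (∀ h h₁ hle φ, (u h h₁ hle φ).1.fn = φ.1.fn) ∧
      (∀ h φ, (π h φ).1.fn = φ.1.fn) ∧
      IsTVSProjectiveLimit u π ∧
      ∀ h h₁ (hlt : h < h₁), IsCompactOperator (u h h₁ hlt.le)) :=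
  proposition60_general s U hU
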